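/- Call a subset $U$ of a topological space $X$ ambiently contractible if the inclusion $U\to X$ is homotopic to a constant map. A Dold space (or numerably contractible space) is a topological space $X$ that has a cover $\{U_\alpha\}_{\alpha\in A}$ by (not necessarily open) ambiently contractible subsets which is numerable, i.e. there is a partition of unity $\{f_\alpha: X\to[0,1]\}_{\alpha\in A}$ by continuous functions such that the family of closed supports $\{\mathrm{Supp}(f_\alpha)\}$ is locally finite and $\mathrm{Supp}(f_\alpha)\subset U_\alpha$ for all $\alpha$. Let $\Delta$ be the category of the ordered sets $[n]=\{0<\dots<n\}$, $n\ge 0$, and order preserving maps, and $\mathrm{Mon}\,\Delta$ its subcategory of injective order preserving maps. Let $\mathrm{Top}$ be the category of all topological spaces, and let $\Delta^n\subset\mathbb{R}^{n+1}$ be the standard $n$-simplex. (1) Let $X_\bullet:(\mathrm{Mon}\,\Delta)^{\mathrm{op}}\to\mathrm{Top}$ be a semisimplicial space. If $X_0$ is a Dold space, then the fat realization $$\|X_\bullet\|=\Big(\coprod_{n\ge 0}X_n\times\Delta^n\Big)\Big/\big((f^*x,s)\sim(x,f_*s),\ f:[m]\to[n]\text{ injective and order preserving},\ x\in X_n,\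 s\in\Delta^m\big),$$ with the quotient topology, is a Dold space. (2) Let $X_\bullet:\Delta^{\mathrm{op}}\to\mathrm{Top}$ be a simplicial space which is proper, i.e. for every $n$ the inclusion $sX_n\subset X_n$ of the subspace of degenerate elements is a closed cofibration ($sX_n$ is closed in $X_n$ and the inclusion has the homotopy extension property with respect to all spaces). If $X_0$ is a Dold space, then the ordinary realization $$|X_\bullet|=\Big(\coprod_{n\ge 0}X_n\times\Delta^n\Big)\Big/\big((f^*x,s)\sim(x,f_*s),\ f:[m]\to[n]\text{ order preserving},\ x\in X_n,\ s\in\Delta^m\big),$$ with the quotient topology, is a Dold space. -/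

import Mathlib

open CategoryTheory Opposite Simplicial

universe u

noncomputable section

/-- A subset `U` of `X` is ambiently contractible if the inclusion `U → X` is nullhomotopic. -/
def IsAmbientlyContractible {X : Type u} [TopologicalSpace X] (U : Set X) : Prop :=
  (ContinuousMap.mk (Subtype.val : U → X) continuous_subtype_val).Nullhomotopic

/-- A (not necessarily open) cover `U` of `X` is numerable if there is a partition of unity
`f` on `X`, with locally finite supports, such that the (closed) support of `f i` is contained
in `U i` for every `i`. -/
def IsNumerableCover {ι X : Type u} [TopologicalSpace X] (U : ι → Set X) : Prop :=
  (⋃ i, U i) = Set.univ ∧ ∃ f : PartitionOfUnity ι X, f.IsSubordinate U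

/-- A Dold space (numerably contractible space): a space with a numerable cover by ambiently
contractible subsets. -/
def IsDoldSpace (X : Type u) [TopologicalSpace X] : Prop :=
  ∃ (ι : Type u) (U : ι → Set X), IsNumerableCover U ∧ ∀ i, IsAmbientlyContractible (U i)

/-- A cofibration (in the sense of Hurewicz): a map `i : A → X` with the homotopy extension
property with respect to all spaces. -/
def IsHurewiczCofibration {A X : Type u} [TopologicalSpace A] [TopologicalSpace X]
    (i : C(A, X)) : Prop :=
  ∀ (Y : Type u) [TopologicalSpace Y] (f : C(X, Y)) (H : C(A × unitInterval, Y)),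
    (∀ a, H (a, 0) = f (i a)) →
    ∃ K : C(X × unitInterval, Y), (∀ x, K (x, 0) = f x) ∧ ∀ a t, K (i a, t) = H (a, t)

/-- A semisimplicial space: a contravariant functor to topological spaces from the category of
the ordered sets `{0 < ... < n}` and injective order preserving maps. -/
abbrev SemisimplicialSpace : Type (u + 1) := SemiSimplexCategoryᵒᵖ ⥤ TopCat.{u}

/-- A simplicial space. -/
abbrev SimplicialSpace : Type (u + 1) := SimplicialObject TopCat.{u}

/-- The gluing relation on `∐ n, X n × Δ^n`: `(f^* x, s) ∼ (x, f_* s)` for all injective order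
preserving maps `f : [m] → [n]`, `x ∈ X n` and `s ∈ Δ^m`. -/
inductive FatRealizationRel (X : SemisimplicialSpace.{u}) :
    (Σ n : SemiSimplexCategory, X.obj (op n) × stdSimplex ℝ (Fin (n.len + 1))) →
    (Σ n : SemiSimplexCategory, X.obj (op n) × stdSimplex ℝ (Fin (n.len + 1))) → Prop where
  | glue {m n : SemiSimplexCategory} (f : m ⟶ n) (x : X.obj (op n))
      (s : stdSimplex ℝ (Fin (m.len + 1))) :
      FatRealizationRel X ⟨m, X.map f.op x, s⟩
        ⟨n, x, stdSimplex.map (SemiSimplexCategory.homEquiv f) s⟩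

/-- The (fat) realization `‖X‖` of a semisimplicial space: the quotient of `∐ n, X n × Δ^n` by
the equivalence relation generated by the gluing relation. -/
def FatRealization (X : SemisimplicialSpace.{u}) : Type u :=
  Quot (FatRealizationRel X)

/-- The quotient topology. -/
instance (X : SemisimplicialSpace.{u}) : TopologicalSpace (FatRealization X) :=
  inferInstanceAs (TopologicalSpace (Quot (FatRealizationRel X)))

/-- The gluing relation on `∐ n, X n × Δ^n`: `(f^* x, s) ∼ (x, f_* s)` for all order preserving
maps `f : [m] → [n]`, `x ∈ X n` and `s ∈ Δ^m`. -/
inductive SlimRealizationRel (X : SimplicialSpace.{u}) :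
    (Σ n : SimplexCategory, X.obj (op n) × stdSimplex ℝ (Fin (n.len + 1))) →
    (Σ n : SimplexCategory, X.obj (op n) × stdSimplex ℝ (Fin (n.len + 1))) → Prop where
  | glue {m n : SimplexCategory} (f : m ⟶ n) (x : X.obj (op n))
      (s : stdSimplex ℝ (Fin (m.len + 1))) :
      SlimRealizationRel X ⟨m, X.map f.op x, s⟩ ⟨n, x, stdSimplex.map f.toOrderHom s⟩

/-- The ordinary (slim) realization `|X|` of a simplicial space: the quotient of
`∐ n, X n × Δ^n` by the equivalence relation generated by the gluing relation. -/
def SlimRealization (X : SimplicialSpace.{u}) : Type u :=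
  Quot (SlimRealizationRel X)

/-- The quotient topology. -/
instance (X : SimplicialSpace.{u}) : TopologicalSpace (SlimRealization X) :=
  inferInstanceAs (TopologicalSpace (Quot (SlimRealizationRel X)))

/-- The subset `sX n` of degenerate elements of `X n`: those in the image of an operator
`X m → X n` with `m < n`. Equivalently, the union of the images of the degeneracies
`s_i : X (n - 1) → X n`. -/
def degenerateElements (X : SimplicialSpace.{u}) (n : ℕ) : Set (X.obj (op ⦋n⦌)) :=
  {x | ∃ (m : ℕ) (_ : m < n) (f : ⦋n⦌ ⟶ ⦋m⦌), x ∈ Set.range (X.map f.op)}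

/-- A simplicial space is proper if for all `n` the inclusion into `X n` of the subspace of
degenerate elements is a closed cofibration. -/
def IsProperSimplicialSpace (X : SimplicialSpace.{u}) : Prop :=
  ∀ n : ℕ, IsClosed (degenerateElements X n) ∧
    IsHurewiczCofibration
      (ContinuousMap.mk (Subtype.val : degenerateElements X n → X.obj (op ⦋n⦌))
        continuous_subtype_val)

end

open Set Filter Topology Function

/-! Both realizations are quotients `Y` of `∐ P n`, with `P n = X n × Δ^n`. Put `L n = sX n × Δ^n ∪
X n × ∂Δ^n`, with `sX n` replaced by `∅` in the fat case. Each point of `Y` has exactly one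
representative outside the `L n`, and points of `L n` are identified with points of lower index.
Each `L n` is a neighbourhood deformation retract of `P n`: the simplex boundary always is one, and
in the proper case the cofibration `sX n ⊂ X n` is combined with it.

The weight function `w n`, which vanishes exactly on `L n`, extends to a continuous function
`extWeight n` on `Y`. Its cozero set `region n` is deformed in `Y`, by running the retractions of
all higher cells one after another (`descent`), into the open stratum `P n \ L n`. The end map lifts
continuously to `∐ P n` (`continuousOn_rep_descent`). Contracting every simplex to its first vertex
shows that `q : ∐ P n → Y` factors up to homotopy through `X 0`. Hence the countably many cozero
sets `region n` cover `Y`, and their inclusions factor up to homotopy through the Dold space `X 0`.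
Pulling back a numerable cover of `X 0` and refining gives the one on `Y`
(`IsDoldSpace.of_countable_cover`). -/

/-! ### Partitions of unity from cozero covers -/

theorem LocallyFinite.exists_partitionOfUnity {ι : Type*} {X : Type*} [TopologicalSpace X]
    (b : ι → C(X, ℝ)) (hb : ∀ i x, 0 ≤ b i x) (hf : LocallyFinite fun i => support (b i))
    (hpos : ∀ x, ∃ i, 0 < b i x) :
    ∃ f : PartitionOfUnity ι X, ∀ i, support (f i) ⊆ support (b i) := by
  have hfin (x : X) : (support fun i => b i x).Finite := hf.point_finite x
  have hs (x : X) : 0 < ∑ᶠ i, b i x := by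
    obtain ⟨i, hi⟩ := hpos x
    exact finsum_pos (fun j => hb j x) ⟨i, hi⟩ (hfin x)
  have hc : Continuous fun x => ∑ᶠ i, b i x := continuous_finsum (fun i => (b i).continuous) hf
  have h1 (x : X) : ∑ᶠ i, b i x / ∑ᶠ j, b j x = 1 := by
    simp_rw [div_eq_mul_inv]
    rw [← finsum_mul' _ _ (hfin x), mul_inv_cancel₀ (hs x).ne']
  have hsup (i : ι) : support (fun x => b i x / ∑ᶠ j, b j x) ⊆ support (b i) := by
    intro x hx hx'
    exact hx (by simp [hx'])
  exact ⟨⟨fun i => ⟨fun x => b i x / ∑ᶠ j, b j x, (b i).continuous.div hc fun x => (hs x).ne'⟩,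
    hf.subset hsup, fun i x => div_nonneg (hb i x) (hs x).le, fun x _ => h1 x,
    fun x => (h1 x).le⟩, hsup⟩

/-- Subtracting `n` times the sum of the earlier functions forces local finiteness: where `b j`
stays above `b j x / 2`, the `n`-th function dies once `n > j` and `n > 2 / b j x`. At the first
index with `b n x > 0` nothing is subtracted, so positivity survives. -/
theorem exists_locallyFinite_of_countable {X : Type*} [TopologicalSpace X]
    (b : ℕ → C(X, ℝ)) (h0 : ∀ n x, 0 ≤ b n x) (h1 : ∀ n x, b n x ≤ 1)
    (hpos : ∀ x, ∃ n, 0 < b n x) :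
    ∃ β : ℕ → C(X, ℝ), (∀ n x, 0 ≤ β n x) ∧ (LocallyFinite fun n => support (β n)) ∧
      (∀ x, ∃ n, 0 < β n x) ∧ ∀ n, support (β n) ⊆ support (b n) := by
  refine ⟨fun n => ⟨fun x => max 0 (b n x - n * ∑ j ∈ Finset.range n, b j x), by fun_prop⟩,
    fun n x => le_max_left _ _, fun x => ?_, fun x => ?_, fun n x hx hx' => hx ?_⟩
  · obtain ⟨j, hj⟩ := hpos x
    have hU : {y | b j x / 2 < b j y} ∈ 𝓝 x :=
      (isOpen_lt continuous_const (b j).continuous).mem_nhds (half_lt_self hj)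
    refine ⟨_, hU, ?_⟩
    obtain ⟨N, hN⟩ := exists_nat_gt (2 / b j x)
    refine (Set.finite_le_nat (max j N)).subset ?_
    rintro n ⟨y, hy, hyU⟩
    simp only [mem_ofPred_eq] at hyU ⊢
    by_contra! hn
    refine hy (max_eq_left ?_)
    have h2 : b j y ≤ ∑ i ∈ Finset.range n, b i y :=
      Finset.single_le_sum (f := fun i => b i y) (fun i _ => h0 i y)
        (Finset.mem_range.2 ((le_max_left _ _).trans_lt hn))
    have h3 : (2 / b j x) < n := hN.trans (by exact_mod_cast (le_max_right _ _).trans_lt hn)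
    rw [div_lt_iff₀ hj] at h3
    have h4 : (n : ℝ) * (b j x / 2) ≤ n * ∑ i ∈ Finset.range n, b i y := by
      have : b j x / 2 ≤ ∑ i ∈ Finset.range n, b i y := hyU.le.trans h2
      gcongr
    linarith [h1 n y]
  · classical
    let n := Nat.find (hpos x)
    refine ⟨n, lt_max_of_lt_right ?_⟩
    have : ∑ j ∈ Finset.range n, b j x = 0 := Finset.sum_eq_zero fun j hj =>
      le_antisymm (not_lt.1 (Nat.find_min (hpos x) (Finset.mem_range.1 hj))) (h0 j x)
    simpa [this] using Nat.find_spec (hpos x)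
  · have : 0 ≤ n * ∑ j ∈ Finset.range n, b j x :=
      mul_nonneg (Nat.cast_nonneg _) (Finset.sum_nonneg fun j _ => h0 j x)
    simpa [hx'] using this

/-- A countable cover by cozero sets has a locally finite refinement by functions whose closed
supports lie in the given sets. -/
theorem exists_locallyFinite_tsupport_subset {X : Type*} [TopologicalSpace X]
    (a : ℕ → C(X, ℝ)) (h1 : ∀ n x, a n x ≤ 1) (hpos : ∀ x, ∃ n, 0 < a n x) :
    ∃ (σ : ℕ → ℕ) (β : ℕ → C(X, ℝ)), (∀ n x, 0 ≤ β n x) ∧ (LocallyFinite fun n => support (β n)) ∧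
      (∀ x, ∃ n, 0 < β n x) ∧ ∀ n, tsupport (β n) ⊆ {x | 0 < a (σ n) x} := by
  -- The index codes a pair `(n, k)`. Truncating `a n` at height `1 / (k + 1)` places the closed
  -- support in `{1 / (k + 1) ≤ a n}`, inside the cozero set of `a n`.
  obtain ⟨β, hβ0, hβf, hβp, hβs⟩ := exists_locallyFinite_of_countable
    (fun n => (⟨fun x => max 0 (a n.unpair.1 x - 1 / (n.unpair.2 + 1)), by fun_prop⟩ : C(X, ℝ)))
    (fun n x => le_max_left _ _)
    (fun n x => max_le zero_le_one (by
      have : (0 : ℝ) ≤ 1 / (n.unpair.2 + 1) := by positivity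
      linarith [h1 n.unpair.1 x]))
    (fun x => by
      obtain ⟨n, hn⟩ := hpos x
      obtain ⟨k, hk⟩ := exists_nat_one_div_lt hn
      refine ⟨Nat.pair n k, lt_max_of_lt_right ?_⟩
      simpa using hk)
  refine ⟨fun n => n.unpair.1, β, hβ0, hβf, hβp, fun n => ?_⟩
  have hcl : IsClosed {x | (1 : ℝ) / (n.unpair.2 + 1) ≤ a n.unpair.1 x} :=
    isClosed_le continuous_const (a _).continuous
  refine (closure_minimal ((hβs n).trans fun x hx => ?_) hcl).trans fun x hx => ?_
  · by_contra h
    refine hx (max_eq_left ?_)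
    simp only [mem_ofPred_eq, not_le] at h
    linarith
  · exact (Nat.one_div_pos_of_nat (α := ℝ) (n := n.unpair.2)).trans_le hx

/-! ### Dold spaces from countable cozero covers -/

/-- A space is a Dold space if it has a countable cover by cozero sets whose inclusions factor up
to homotopy through a fixed map from a Dold space. -/
theorem IsDoldSpace.of_countable_cover {B Y : Type u} [TopologicalSpace B] [TopologicalSpace Y]
    (hB : IsDoldSpace B) (j : C(B, Y)) (a : ℕ → C(Y, ℝ)) (h1 : ∀ n y, a n y ≤ 1)
    (hpos : ∀ y, ∃ n, 0 < a n y) (ρ : ∀ n, C({y | 0 < a n y}, B))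
    (hρ : ∀ n, (ContinuousMap.mk (Subtype.val : {y | 0 < a n y} → Y)
      continuous_subtype_val).Homotopic (j.comp (ρ n))) : IsDoldSpace Y := by
  classical
  obtain ⟨ι, U, ⟨-, g, hg⟩, hU⟩ := hB
  obtain ⟨σ, β, hβ0, hβf, hβp, hβs⟩ := exists_locallyFinite_tsupport_subset a h1 hpos
  let V (n : ℕ) : Set Y := {y | 0 < a (σ n) y}
  have hVo (n : ℕ) : IsOpen (V n) := isOpen_lt continuous_const (a _).continuous
  let W (k : ℕ × ι) : Set Y := {y | ∃ hy : y ∈ V k.1, ρ (σ k.1) ⟨y, hy⟩ ∈ U k.2}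
  -- The extension by zero need not be continuous. Its product with `β k.1` is, since the closed
  -- support of `β k.1` lies in the open set `V k.1`.
  let γ (k : ℕ × ι) (y : Y) : ℝ := if hy : y ∈ V k.1 then g k.2 (ρ (σ k.1) ⟨y, hy⟩) else 0
  have hγc (k : ℕ × ι) : ContinuousOn (γ k) (V k.1) := by
    rw [continuousOn_iff_continuous_domRestrict]
    have : (V k.1).domRestrict (γ k) = fun y => g k.2 (ρ (σ k.1) y) := by
      ext y
      simp [γ, domRestrict]
    rw [this]
    fun_prop
  have hγ0 (k : ℕ × ι) (y : Y) : 0 ≤ γ k y := by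
    simp only [γ]
    split_ifs
    exacts [g.nonneg _ _, le_rfl]
  have hψs (k : ℕ × ι) : support (fun y => β k.1 y * γ k y) ⊆ support (β k.1) :=
    fun y hy hy' => hy (by simp [hy'])
  have hψc (k : ℕ × ι) : Continuous fun y => β k.1 y * γ k y := by
    refine ContinuousOn.continuous_of_tsupport_subset ?_ (hVo k.1)
      ((closure_mono (hψs k)).trans (hβs k.1))
    exact (β k.1).continuous.continuousOn.mul (hγc k)
  have hlf : LocallyFinite fun k : ℕ × ι => support fun y => β k.1 y * γ k y := by
    intro y
    -- For fixed `n`, local finiteness is pulled back from `g` on `V n`, and off `V n` the closed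
    -- support of `β n` is avoided. Near `y` only finitely many `n` matter.
    have key (n : ℕ) : ∃ N ∈ 𝓝 y,
        Set.Finite {i | ((support (fun y => β n y * γ (n, i) y)) ∩ N).Nonempty} := by
      by_cases hy : y ∈ V n
      · obtain ⟨M, hM, hMf⟩ := g.locallyFinite (ρ (σ n) ⟨y, hy⟩)
        have h2 : (ρ (σ n)) ⁻¹' M ∈ 𝓝 (⟨y, hy⟩ : V n) := (ρ (σ n)).continuousAt _ hM
        refine ⟨Subtype.val '' ((ρ (σ n)) ⁻¹' M),
          (hVo n).isOpenMap_subtype_val.image_mem_nhds h2, hMf.subset ?_⟩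
        rintro i ⟨_, hz, z, hzM, rfl⟩
        refine ⟨ρ (σ n) z, fun h => hz ?_, hzM⟩
        have hz2 : (z : Y) ∈ V n := z.2
        simp [γ, hz2, h]
      · refine ⟨(tsupport (β n))ᶜ, (isClosed_tsupport _).isOpen_compl.mem_nhds
          fun h => hy (hβs n h), Set.finite_empty.subset ?_⟩
        rintro i ⟨z, hz, hz'⟩
        exact hz' (subset_tsupport _ (hψs (n, i) hz))
    choose N hN hNf using key
    obtain ⟨M, hM, hMf⟩ := hβf y
    refine ⟨M ∩ ⋂ n ∈ hMf.toFinset, N n,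
      inter_mem hM ((Filter.biInter_finset_mem _).2 fun n _ => hN n), ?_⟩
    refine (hMf.biUnion fun n _ => (hNf n).image (Prod.mk n)).subset ?_
    rintro ⟨n, i⟩ ⟨z, hz, hzM, hzN⟩
    have hn : n ∈ {n | ((support (β n)) ∩ M).Nonempty} := ⟨z, hψs _ hz, hzM⟩
    exact mem_biUnion hn ⟨i, ⟨z, hz, mem_iInter₂.1 hzN n (hMf.mem_toFinset.2 hn)⟩, rfl⟩
  obtain ⟨f, hf⟩ := LocallyFinite.exists_partitionOfUnity
    (fun k : ℕ × ι => (⟨fun y => β k.1 y * γ k y, hψc k⟩ : C(Y, ℝ)))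
    (fun k y => mul_nonneg (hβ0 _ _) (hγ0 _ _)) hlf (fun y => by
      obtain ⟨n, hn⟩ := hβp y
      have hy : y ∈ V n := hβs n (subset_tsupport _ hn.ne')
      obtain ⟨i, hi⟩ := g.exists_pos (mem_univ (ρ (σ n) ⟨y, hy⟩))
      refine ⟨(n, i), mul_pos hn ?_⟩
      simpa [γ, hy] using hi)
  have hsub : f.IsSubordinate W := by
    intro k y hy
    have hy1 : y ∈ V k.1 := hβs k.1 (closure_mono ((hf k).trans (hψs k)) hy)
    refine ⟨hy1, hg k.2 ?_⟩
    by_contra h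
    have h2 : (ρ (σ k.1)) ⁻¹' (tsupport (g k.2))ᶜ ∈ 𝓝 (⟨y, hy1⟩ : V k.1) :=
      (ρ (σ k.1)).continuousAt _ ((isClosed_tsupport _).isOpen_compl.mem_nhds h)
    have h3 := (hVo k.1).isOpenMap_subtype_val.image_mem_nhds h2
    obtain ⟨_, ⟨z, hz, rfl⟩, hz'⟩ := mem_closure_iff_nhds.1 hy _ h3
    refine hf k hz' ?_
    have hz2 : (z : Y) ∈ V k.1 := z.2
    have : g k.2 (ρ (σ k.1) z) = 0 := by
      by_contra h'
      exact hz (subset_tsupport _ h')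
    simp [γ, hz2, this]
  refine ⟨ℕ × ι, W, ⟨?_, f, hsub⟩, fun k => ?_⟩
  · refine eq_univ_of_forall fun y => ?_
    obtain ⟨k, hk⟩ := f.exists_pos (mem_univ y)
    exact mem_iUnion.2 ⟨k, hsub k (subset_tsupport _ hk.ne')⟩
  -- On `W k` the inclusion is homotopic to a map factoring through `U k.2 → B`, which is
  -- nullhomotopic.
  · let iW : C(W k, V k.1) := ⟨fun y => ⟨y.1, y.2.1⟩, by fun_prop⟩
    let r : C(W k, U k.2) := ⟨fun y => ⟨ρ (σ k.1) (iW y), y.2.2⟩, by fun_prop⟩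
    obtain ⟨y, hy⟩ := ((hU k.2).comp_right j).comp_left r
    exact ⟨y, ((hρ (σ k.1)).comp (.refl iW)).trans hy⟩

/-! ### Skeletal presentations and gluing of continuous maps -/

/-- A presentation of a space `Y` by attaching, for each `n`, the space `P n` along a closed
subspace `L n` equipped with the structure of a neighbourhood deformation retract. -/
structure SkeletalPresentation (P : ℕ → Type u) [∀ n, TopologicalSpace (P n)] (Y : Type u)
    [TopologicalSpace Y] where
  q : C(Σ n, P n, Y)
  isQuotientMap : IsQuotientMap q
  L : ∀ n, Set (P n)
  L_zero : L 0 = ∅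
  J : ℕ → Type
  finite_J : ∀ n, Finite (J n)
  C : ∀ n, J n → Set (P (n + 1))
  isClosed_C : ∀ n j, IsClosed (C n j)
  c : ∀ n, J n → C(P (n + 1), P n)
  L_succ : ∀ n, L (n + 1) = ⋃ j, C n j
  q_c : ∀ n j p, p ∈ C n j → q ⟨n + 1, p⟩ = q ⟨n, c n j p⟩
  eq_of_q_eq : ∀ x y : Σ n, P n, x.2 ∉ L x.1 → y.2 ∉ L y.1 → q x = q y → x = y
  w : ∀ n, C(P n, ℝ)
  w_nonneg : ∀ n p, 0 ≤ w n p
  w_le_one : ∀ n p, w n p ≤ 1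
  w_eq_zero : ∀ n p, w n p = 0 ↔ p ∈ L n
  H : ∀ n, C(P n × unitInterval, P n)
  H_zero : ∀ n p, H n (p, 0) = p
  H_of_mem : ∀ n p t, p ∈ L n → H n (p, t) = p
  H_one_mem : ∀ n p, w n p < 1 → H n (p, 1) ∈ L n

namespace SkeletalPresentation

variable {P : ℕ → Type u} [∀ n, TopologicalSpace (P n)] {Y : Type u} [TopologicalSpace Y]
  (D : SkeletalPresentation P Y)

theorem exists_rep (n : ℕ) (p : P n) :
    ∃ x : Σ n, P n, x.2 ∉ D.L x.1 ∧ D.q x = D.q ⟨n, p⟩ := by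
  induction n with
  | zero => exact ⟨⟨0, p⟩, by simp [D.L_zero], rfl⟩
  | succ n ih =>
    by_cases hp : p ∈ D.L (n + 1)
    · rw [D.L_succ, mem_iUnion] at hp
      obtain ⟨j, hj⟩ := hp
      obtain ⟨x, hx, hx'⟩ := ih (D.c n j p)
      exact ⟨x, hx, hx'.trans (D.q_c n j p hj).symm⟩
    · exact ⟨⟨n + 1, p⟩, hp, rfl⟩

theorem exists_rep' (y : Y) : ∃ x : Σ n, P n, x.2 ∉ D.L x.1 ∧ D.q x = y := by
  obtain ⟨⟨n, p⟩, rfl⟩ := D.isQuotientMap.surjective y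
  exact D.exists_rep n p

/-- The unique representative of a point outside the attaching loci. -/
noncomputable def rep (y : Y) : Σ n, P n := (D.exists_rep' y).choose

theorem rep_notMem (y : Y) : (D.rep y).2 ∉ D.L (D.rep y).1 := (D.exists_rep' y).choose_spec.1

@[simp] theorem q_rep (y : Y) : D.q (D.rep y) = y := (D.exists_rep' y).choose_spec.2

/-- The index of the cell containing a point. -/
noncomputable def dim (y : Y) : ℕ := (D.rep y).1

theorem rep_q {n : ℕ} {p : P n} (hp : p ∉ D.L n) : D.rep (D.q ⟨n, p⟩) = ⟨n, p⟩ :=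
  D.eq_of_q_eq _ _ (D.rep_notMem _) hp (D.q_rep _)

theorem dim_q_le (n : ℕ) (p : P n) : D.dim (D.q ⟨n, p⟩) ≤ n := by
  induction n with
  | zero => simp [dim, D.rep_q (show p ∉ D.L 0 by simp [D.L_zero])]
  | succ n ih =>
    by_cases hp : p ∈ D.L (n + 1)
    · rw [D.L_succ, mem_iUnion] at hp
      obtain ⟨j, hj⟩ := hp
      rw [D.q_c n j p hj]
      exact (ih _).trans n.le_succ
    · simp [dim, D.rep_q hp]

theorem dim_q_lt {n : ℕ} {p : P n} (hp : p ∈ D.L n) : D.dim (D.q ⟨n, p⟩) < n := by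
  cases n with
  | zero => simp [D.L_zero] at hp
  | succ n =>
    rw [D.L_succ, mem_iUnion] at hp
    obtain ⟨j, hj⟩ := hp
    rw [D.q_c n j p hj]
    exact Nat.lt_succ_of_le (D.dim_q_le _ _)

/-- `L (n + 1)` is a finite union of closed sets, on each of which `q` factors through `P n` by a
continuous map. This is what lets continuity be proved by induction on the cells. -/
theorem continuousOn_L_succ {S T : Type*} [TopologicalSpace S] [TopologicalSpace T]
    (F : Y → S → T) (V : Set Y) (n : ℕ)
    (hF : ContinuousOn (fun z : P n × S => F (D.q ⟨n, z.1⟩) z.2) {z | D.q ⟨n, z.1⟩ ∈ V}) :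
    ContinuousOn (fun z : P (n + 1) × S => F (D.q ⟨n + 1, z.1⟩) z.2)
      {z | z.1 ∈ D.L (n + 1) ∧ D.q ⟨n + 1, z.1⟩ ∈ V} := by
  have := D.finite_J n
  have hu : ({z | z.1 ∈ D.L (n + 1) ∧ D.q ⟨n + 1, z.1⟩ ∈ V} : Set (P (n + 1) × S)) =
      ⋃ j, {z | z.1 ∈ D.C n j ∧ D.q ⟨n + 1, z.1⟩ ∈ V} := by
    ext z
    simp [D.L_succ]
  rw [hu]
  intro z hz
  rw [ContinuousWithinAt, nhdsWithin_iUnion]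
  refine tendsto_iSup.2 fun j => ?_
  by_cases hj : z.1 ∈ D.C n j
  · have hzV : D.q ⟨n + 1, z.1⟩ ∈ V := by
      obtain ⟨i, hi⟩ := mem_iUnion.1 hz
      exact hi.2
    have h1 : ContinuousOn (fun z : P (n + 1) × S => F (D.q ⟨n, D.c n j z.1⟩) z.2)
        {z | z.1 ∈ D.C n j ∧ D.q ⟨n + 1, z.1⟩ ∈ V} := by
      refine hF.comp (f := fun z : P (n + 1) × S => (D.c n j z.1, z.2))
        (by fun_prop) fun z hz => ?_
      simp only [mem_ofPred_eq, ← D.q_c n j z.1 hz.1]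
      exact hz.2
    exact (h1.congr fun z hz => by simp only [D.q_c n j z.1 hz.1]) z ⟨hj, hzV⟩
  · have h2 : 𝓝[({z | z.1 ∈ D.C n j ∧ D.q ⟨n + 1, z.1⟩ ∈ V} : Set (P (n + 1) × S))] z = ⊥ := by
      rw [← notMem_closure_iff_nhdsWithin_eq_bot]
      intro h
      exact hj (closure_minimal (fun z hz => hz.1)
        ((D.isClosed_C n j).preimage continuous_fst) h)
    simp [h2]

/-- Restricting `q` to an open set gives a quotient map, which remains one after taking the product
with a locally compact space. -/
theorem continuousOn_of_forall {S T : Type*} [TopologicalSpace S] [LocallyCompactSpace S]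
    [TopologicalSpace T] (F : Y → S → T) {V : Set Y} (hV : IsOpen V)
    (hF : ∀ n, ContinuousOn (fun z : P n × S => F (D.q ⟨n, z.1⟩) z.2) {z | D.q ⟨n, z.1⟩ ∈ V}) :
    ContinuousOn (fun z : Y × S => F z.1 z.2) {z | z.1 ∈ V} := by
  have hq := D.isQuotientMap.restrictPreimage_isOpen hV
  have h1 : Continuous fun z : V × S => F z.1 z.2 := by
    refine hq.continuous_lift_prod_left (g := fun z : V × S => F z.1 z.2) ?_
    rw [continuous_iff_continuousAt]
    rintro ⟨⟨⟨n, p⟩, hp⟩, s⟩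
    have hp' : D.q ⟨n, p⟩ ∈ V := hp
    have h2 : ContinuousAt (fun z : P n × S => F (D.q ⟨n, z.1⟩) z.2) (p, s) :=
      (hF n).continuousAt ((hV.preimage (by fun_prop)).mem_nhds hp')
    have h3 : ContinuousAt (fun z : (Σ n, P n) × S => F (D.q z.1) z.2) (⟨n, p⟩, s) := by
      have he : IsOpenEmbedding (Prod.map (Sigma.mk n) id : P n × S → (Σ n, P n) × S) :=
        Topology.IsOpenEmbedding.sigmaMk.prodMap .id
      exact (he.continuousAt_iff (g := fun z : (Σ n, P n) × S => F (D.q z.1) z.2)).1 h2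
    exact h3.comp (x := (⟨⟨n, p⟩, hp⟩, s)) (f := fun z : (D.q ⁻¹' V) × S => ((z.1 : Σ n, P n), z.2))
      (Continuous.continuousAt (by fun_prop))
  rw [continuousOn_iff_continuous_domRestrict]
  exact h1.comp (f := fun z : ({z | z.1 ∈ V} : Set (Y × S)) => ((⟨z.1.1, z.2⟩ : V), z.1.2))
    (by fun_prop)

/-! ### Flows and extended weight functions -/

open Classical in
/-- The deformation of the `m`-th cell, extended by the identity. -/
noncomputable def flow (m : ℕ) (y : Y) (t : unitInterval) : Y :=
  if D.dim y = m then D.q ⟨_, D.H _ ((D.rep y).2, t)⟩ else y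

open Classical in
/-- The weight function of the `m`-th cell, extended by zero. -/
noncomputable def weight (m : ℕ) (y : Y) : ℝ := if D.dim y = m then D.w _ (D.rep y).2 else 0

/-- The case split disappears on `P m`, because `H m` fixes `L m` pointwise. -/
theorem flow_q (m : ℕ) (p : P m) (t : unitInterval) :
    D.flow m (D.q ⟨m, p⟩) t = D.q ⟨m, D.H m (p, t)⟩ := by
  by_cases hp : p ∈ D.L m
  · rw [flow, if_neg (D.dim_q_lt hp).ne, D.H_of_mem m p t hp]
  · rw [flow, dim, D.rep_q hp, if_pos rfl]

theorem weight_q (m : ℕ) (p : P m) : D.weight m (D.q ⟨m, p⟩) = D.w m p := by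
  by_cases hp : p ∈ D.L m
  · rw [weight, if_neg (D.dim_q_lt hp).ne, (D.w_eq_zero m p).2 hp]
  · rw [weight, dim, D.rep_q hp, if_pos rfl]

theorem flow_of_ne {m : ℕ} {y : Y} (h : D.dim y ≠ m) (t : unitInterval) : D.flow m y t = y :=
  if_neg h

theorem weight_of_ne {m : ℕ} {y : Y} (h : D.dim y ≠ m) : D.weight m y = 0 := if_neg h

theorem flow_zero (m : ℕ) (y : Y) : D.flow m y 0 = y := by
  rw [flow]
  split_ifs
  · rw [D.H_zero]
    exact D.q_rep y
  · rfl

/-- Approximations of `extWeight`. -/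
noncomputable def extWeightAux (n k : ℕ) (y : Y) : ℝ := match k with
  | 0 => D.weight n y
  | k + 1 => max 0 (1 - 2 * D.weight (n + k + 1) y) * extWeightAux n k (D.flow (n + k + 1) y 1)

/-- The extension of the weight function of the `n`-th cell to a continuous function on the whole
space, obtained by flowing down along the higher cells. -/
noncomputable def extWeight (n : ℕ) (y : Y) : ℝ := D.extWeightAux n (D.dim y) y

/-- Above the dimension of `y` the extra factors equal `1` and the flows fix `y`, so the recursion
has stabilised. -/
theorem extWeightAux_eq {n k : ℕ} {y : Y} (h : D.dim y ≤ n + k) :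
    D.extWeightAux n k y = D.extWeight n y := by
  have key (k l : ℕ) (h : D.dim y ≤ n + k) (hl : k ≤ l) :
      D.extWeightAux n l y = D.extWeightAux n k y := by
    induction l, hl using Nat.le_induction with
    | base => rfl
    | succ l hl ih =>
      have h1 : D.dim y ≠ n + l + 1 := by lia
      rw [extWeightAux, D.weight_of_ne h1, D.flow_of_ne h1, ih]
      simp
  rw [extWeight, ← key k (max k (D.dim y)) h (le_max_left _ _),
    ← key (D.dim y) (max k (D.dim y)) (by lia) (le_max_right _ _)]

theorem extWeight_of_lt {n : ℕ} {y : Y} (h : D.dim y < n) : D.extWeight n y = 0 := by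
  rw [← D.extWeightAux_eq (k := 0) h.le, extWeightAux, D.weight_of_ne h.ne]

theorem extWeight_q_self (n : ℕ) (p : P n) : D.extWeight n (D.q ⟨n, p⟩) = D.w n p := by
  rw [← D.extWeightAux_eq (n := n) (k := 0) (D.dim_q_le n p), extWeightAux, D.weight_q]

theorem extWeight_q_of_lt {n m : ℕ} (h : n < m) (p : P m) :
    D.extWeight n (D.q ⟨m, p⟩) =
      max 0 (1 - 2 * D.w m p) * D.extWeight n (D.q ⟨m, D.H m (p, 1)⟩) := by
  obtain ⟨k, rfl⟩ := Nat.exists_eq_add_of_lt h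
  rw [← D.extWeightAux_eq (n := n) (k := k + 1) (D.dim_q_le (n + k + 1) p), extWeightAux,
    D.weight_q, D.flow_q]
  -- If `w p < 1`, the flow ends in `L`, so the dimension drops and the recursion is already stable
  -- one step lower. Otherwise the cutoff factor kills both sides.
  rcases lt_or_ge (D.w (n + k + 1) p) 1 with hw | hw
  · rw [D.extWeightAux_eq (Nat.lt_succ_iff.1 (D.dim_q_lt (D.H_one_mem _ p hw)))]
  · rw [max_eq_left (by linarith)]
    simp

theorem extWeight_le_one (n : ℕ) (y : Y) : D.extWeight n y ≤ 1 := by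
  have hw (m : ℕ) (y : Y) : 0 ≤ D.weight m y ∧ D.weight m y ≤ 1 := by
    rw [weight]
    split_ifs
    exacts [⟨D.w_nonneg _ _, D.w_le_one _ _⟩, ⟨le_rfl, zero_le_one⟩]
  have key (k : ℕ) : ∀ y, 0 ≤ D.extWeightAux n k y ∧ D.extWeightAux n k y ≤ 1 := by
    induction k with
    | zero => exact hw n
    | succ k ih =>
      intro y
      have h1 := ih (D.flow (n + k + 1) y 1)
      refine ⟨mul_nonneg (le_max_left _ _) h1.1, mul_le_one₀ (max_le zero_le_one ?_) h1.1 h1.2⟩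
      linarith [(hw (n + k + 1) y).1]
  exact (key _ _).2

/-- The recursion formula is continuous where `w < 1`, since the flow ends in `L` there. Where `w >
1 / 2` the cutoff `max 0 (1 - 2 * w)` is zero; these two open sets overlap and cover, which is why
the factor `2` is there. -/
theorem continuous_extWeight (n : ℕ) : Continuous (D.extWeight n) := by
  have key (m : ℕ) : Continuous fun p : P m => D.extWeight n (D.q ⟨m, p⟩) := by
    induction m with
    | zero =>
      rcases Nat.eq_zero_or_pos n with rfl | hn
      · simp_rw [extWeight_q_self]
        fun_prop
      · simp_rw [D.extWeight_of_lt ((D.dim_q_le 0 _).trans_lt hn)]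
        fun_prop
    | succ m ih =>
      rcases lt_trichotomy (m + 1) n with hn | rfl | hn
      · simp_rw [D.extWeight_of_lt ((D.dim_q_le (m + 1) _).trans_lt hn)]
        fun_prop
      · simp_rw [extWeight_q_self]
        fun_prop
      · rw [funext fun p => D.extWeight_q_of_lt hn p]
        have h1 := D.continuousOn_L_succ (S := Unit) (fun y _ => D.extWeight n y) univ m
          (ih.comp continuous_fst).continuousOn
        have h2 : ContinuousOn (fun p : P (m + 1) =>
            D.extWeight n (D.q ⟨m + 1, D.H (m + 1) (p, 1)⟩)) {p | D.w (m + 1) p < 1} :=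
          h1.comp (f := fun p : P (m + 1) => (D.H (m + 1) (p, 1), ())) (by fun_prop)
            fun p hp => ⟨D.H_one_mem _ _ hp, mem_univ _⟩
        rw [continuous_iff_continuousAt]
        intro p
        rcases lt_or_ge (D.w (m + 1) p) 1 with hp | hp
        · refine ContinuousAt.mul (by fun_prop) (h2.continuousAt ?_)
          exact (isOpen_lt (D.w (m + 1)).continuous continuous_const).mem_nhds hp
        · have h3 : {p | 1 / 2 < D.w (m + 1) p} ∈ 𝓝 p :=
            (isOpen_lt continuous_const (D.w (m + 1)).continuous).mem_nhds
              (show 1 / 2 < D.w (m + 1) p by linarith)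
          refine (continuousAt_const (y := (0 : ℝ))).congr (Filter.mem_of_superset h3 fun p hp => ?_)
          have hp' : 1 / 2 < D.w (m + 1) p := hp
          simp only [mem_ofPred_eq]
          rw [max_eq_left (by linarith), zero_mul]
  rw [D.isQuotientMap.continuous_iff, continuous_sigma_iff]
  exact key

/-! ### Descent to the open stratum -/

/-- The schedule of the `k`-th step of the infinite concatenation of flows: the step takes place
during `[2 ^ (-k-1), 2 ^ (-k)]`. -/
noncomputable def schedule (k : ℕ) : C(unitInterval, unitInterval) :=
  ⟨fun t => projIcc 0 1 zero_le_one ((2 : ℝ) ^ (k + 1) * t - 1),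
    continuous_projIcc.comp (by fun_prop)⟩

theorem schedule_of_le {k : ℕ} {t : unitInterval} (h : (2 : ℝ) ^ (k + 1) * t ≤ 1) :
    schedule k t = 0 :=
  projIcc_of_le_left zero_le_one (by linarith)

theorem schedule_of_ge {k : ℕ} {t : unitInterval} (h : 1 ≤ (2 : ℝ) ^ k * t) :
    schedule k t = 1 :=
  projIcc_of_right_le zero_le_one (by rw [pow_succ]; linarith)

/-- Approximations of `descent`. -/
noncomputable def descentAux (n k : ℕ) (y : Y) (t : unitInterval) : Y := match k with
  | 0 => y
  | k + 1 => descentAux n k (D.flow (n + k + 1) y (schedule k t)) t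

/-- The infinite concatenation of the flows of all cells of index larger than `n`. -/
noncomputable def descent (n : ℕ) (y : Y) (t : unitInterval) : Y := D.descentAux n (D.dim y) y t

theorem descentAux_eq {n k : ℕ} {y : Y} (h : D.dim y ≤ n + k) (t : unitInterval) :
    D.descentAux n k y t = D.descent n y t := by
  have key (k l : ℕ) (h : D.dim y ≤ n + k) (hl : k ≤ l) :
      D.descentAux n l y t = D.descentAux n k y t := by
    induction l, hl using Nat.le_induction with
    | base => rfl
    | succ l hl ih => rw [descentAux, D.flow_of_ne (by lia), ih]
  rw [descent, ← key k (max k (D.dim y)) h (le_max_left _ _),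
    ← key (D.dim y) (max k (D.dim y)) (by lia) (le_max_right _ _)]

/-- The steps below `k` start at time `2 ^ (-k)` or later, so none has begun yet. -/
theorem descentAux_of_le {n k : ℕ} {t : unitInterval} (h : (2 : ℝ) ^ k * t ≤ 1) (y : Y) :
    D.descentAux n k y t = y := by
  induction k with
  | zero => rfl
  | succ k ih =>
    rw [descentAux, schedule_of_le h, D.flow_zero]
    refine ih (le_trans ?_ h)
    have := t.2.1
    gcongr <;> norm_num

theorem descent_zero (n : ℕ) (y : Y) : D.descent n y 0 = y := D.descentAux_of_le (by simp) y

theorem descent_q_of_le {n m : ℕ} (h : m ≤ n) (p : P m) (t : unitInterval) :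
    D.descent n (D.q ⟨m, p⟩) t = D.q ⟨m, p⟩ := by
  rw [← D.descentAux_eq (k := 0) ((D.dim_q_le _ _).trans h), descentAux]

theorem descent_q_of_mul_le {n k : ℕ} (p : P (n + k + 1)) {t : unitInterval}
    (ht : (2 : ℝ) ^ k * t ≤ 1) :
    D.descent n (D.q ⟨n + k + 1, p⟩) t = D.q ⟨n + k + 1, D.H _ (p, schedule k t)⟩ := by
  rw [← D.descentAux_eq (n := n) (k := k + 1) (D.dim_q_le (n + k + 1) p), descentAux,
    D.descentAux_of_le ht, D.flow_q]

/-- After time `2 ^ (-k)` the step of this cell is complete and the point has landed in `L`; what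
remains is the descent of that lower point. -/
theorem descent_q_of_le_mul {n k : ℕ} {p : P (n + k + 1)} {t : unitInterval}
    (ht : 1 ≤ (2 : ℝ) ^ k * t) (hp : D.w _ p < 1) :
    D.descent n (D.q ⟨n + k + 1, p⟩) t = D.descent n (D.q ⟨n + k + 1, D.H _ (p, 1)⟩) t := by
  rw [← D.descentAux_eq (n := n) (k := k + 1) (D.dim_q_le (n + k + 1) p), descentAux,
    D.flow_q, schedule_of_ge ht,
    D.descentAux_eq (Nat.lt_succ_iff.1 (D.dim_q_lt (D.H_one_mem _ p hp)))]

/-- The points at which the `n`-th extended weight function does not vanish. -/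
def region (n : ℕ) : Set Y := {y | 0 < D.extWeight n y}

theorem isOpen_region (n : ℕ) : IsOpen (D.region n) :=
  isOpen_lt continuous_const (D.continuous_extWeight n)

/-- A positive product has positive cutoff, so `w < 1 / 2`, and positive second factor, so the
endpoint of the flow is again in the region. -/
theorem of_mem_region {n m : ℕ} (h : n < m) {p : P m} (hp : D.q ⟨m, p⟩ ∈ D.region n) :
    D.w m p < 1 ∧ D.q ⟨m, D.H m (p, 1)⟩ ∈ D.region n := by
  have hp' : 0 < D.extWeight n (D.q ⟨m, p⟩) := hp
  rw [D.extWeight_q_of_lt h] at hp'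
  have h1 : 0 < max 0 (1 - 2 * D.w m p) := by
    refine lt_of_le_of_ne (le_max_left _ _) fun h0 => ?_
    simp [← h0] at hp'
  refine ⟨?_, pos_of_mul_pos_right hp' h1.le⟩
  rcases lt_max_iff.1 h1 with h2 | h2 <;> linarith

theorem dim_ge_of_mem_region {n : ℕ} {y : Y} (hy : y ∈ D.region n) : n ≤ D.dim y := by
  by_contra! h
  exact (D.extWeight_of_lt h).not_gt hy

/-- By induction on the cell: cutting the time interval at `2 ^ (-k)` gives two closed pieces, the
cell's own retraction and then the descent of its endpoint in `L`. -/
theorem continuousOn_descent (n : ℕ) :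
    ContinuousOn (fun z : Y × unitInterval => D.descent n z.1 z.2) {z | z.1 ∈ D.region n} := by
  refine D.continuousOn_of_forall _ (D.isOpen_region n) fun m => ?_
  induction m with
  | zero =>
    simp_rw [D.descent_q_of_le n.zero_le]
    fun_prop
  | succ m ih =>
    rcases le_or_gt (m + 1) n with hn | hn
    · simp_rw [D.descent_q_of_le hn]
      fun_prop
    · have h1 := D.continuousOn_L_succ _ _ m ih
      obtain ⟨k, rfl⟩ : ∃ k, m = n + k := Nat.exists_eq_add_of_le (Nat.lt_succ_iff.1 hn)
      have h2 : ContinuousOn (fun z : P (n + k + 1) × unitInterval =>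
          D.descent n (D.q ⟨n + k + 1, D.H _ (z.1, 1)⟩) z.2)
          {z | D.q ⟨n + k + 1, z.1⟩ ∈ D.region n} :=
        h1.comp (f := fun z : P (n + k + 1) × unitInterval => (D.H (n + k + 1) (z.1, 1), z.2))
          (by fun_prop) fun z hz =>
            ⟨D.H_one_mem _ _ (D.of_mem_region hn hz).1, (D.of_mem_region hn hz).2⟩
      have hu : ({z | D.q ⟨n + k + 1, z.1⟩ ∈ D.region n} : Set (P (n + k + 1) × unitInterval)) =
          {z | D.q ⟨n + k + 1, z.1⟩ ∈ D.region n} ∩ {z | (2 : ℝ) ^ k * z.2 ≤ 1} ∪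
          {z | D.q ⟨n + k + 1, z.1⟩ ∈ D.region n} ∩ {z | 1 ≤ (2 : ℝ) ^ k * z.2} := by
        rw [← inter_union_distrib_left, eq_comm, inter_eq_left]
        intro z _
        exact le_total ((2 : ℝ) ^ k * z.2) 1
      have h3 : ContinuousOn (fun z : P (n + k + 1) × unitInterval =>
          D.descent n (D.q ⟨n + k + 1, z.1⟩) z.2)
          ({z | D.q ⟨n + k + 1, z.1⟩ ∈ D.region n} ∩ {z | (2 : ℝ) ^ k * z.2 ≤ 1}) := by
        refine ContinuousOn.congr (f := fun z : P (n + k + 1) × unitInterval =>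
          D.q ⟨n + k + 1, D.H _ (z.1, schedule k z.2)⟩) (by fun_prop) fun z hz => ?_
        exact D.descent_q_of_mul_le z.1 hz.2
      have h4 : ContinuousOn (fun z : P (n + k + 1) × unitInterval =>
          D.descent n (D.q ⟨n + k + 1, z.1⟩) z.2)
          ({z | D.q ⟨n + k + 1, z.1⟩ ∈ D.region n} ∩ {z | 1 ≤ (2 : ℝ) ^ k * z.2}) := by
        refine (h2.mono inter_subset_left).congr fun z hz => ?_
        exact D.descent_q_of_le_mul hz.2 (D.of_mem_region hn hz.1).1
      intro z hz
      rw [hu, continuousWithinAt_union]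
      have hc1 : IsClosed ({z | (2 : ℝ) ^ k * z.2 ≤ 1} : Set (P (n + k + 1) × unitInterval)) :=
        isClosed_le (by fun_prop) continuous_const
      have hc2 : IsClosed ({z | 1 ≤ (2 : ℝ) ^ k * z.2} : Set (P (n + k + 1) × unitInterval)) :=
        isClosed_le continuous_const (by fun_prop)
      constructor
      · by_cases hz' : z ∈ ({z | (2 : ℝ) ^ k * z.2 ≤ 1} : Set (P (n + k + 1) × unitInterval))
        · exact h3 z ⟨hz, hz'⟩
        · refine continuousWithinAt_of_notMem_closure fun h => hz' ?_
          exact closure_minimal inter_subset_right hc1 h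
      · by_cases hz' : z ∈ ({z | 1 ≤ (2 : ℝ) ^ k * z.2} : Set (P (n + k + 1) × unitInterval))
        · exact h4 z ⟨hz, hz'⟩
        · refine continuousWithinAt_of_notMem_closure fun h => hz' ?_
          exact closure_minimal inter_subset_right hc2 h

/-- `rep` alone need not be continuous. Descent from `region n` ends at points of dimension exactly
`n`, where `rep` inverts `q` on `P n \ L n`. -/
theorem continuousOn_rep_descent (n : ℕ) :
    ContinuousOn (fun y => D.rep (D.descent n y 1)) (D.region n) := by
  suffices h : ContinuousOn (fun z : Y × Unit => D.rep (D.descent n z.1 1))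
      {z | z.1 ∈ D.region n} from
    h.comp (f := fun y => (y, ())) (by fun_prop) fun y hy => hy
  refine D.continuousOn_of_forall (fun y _ => D.rep (D.descent n y 1))
    (D.isOpen_region n) fun m => ?_
  have hself : ContinuousOn (fun z : P n × Unit => D.rep (D.descent n (D.q ⟨n, z.1⟩) 1))
      {z | D.q ⟨n, z.1⟩ ∈ D.region n} := by
    refine ContinuousOn.congr (f := fun z : P n × Unit => (⟨n, z.1⟩ : Σ n, P n))
      (by fun_prop) fun z hz => ?_
    simp only [D.descent_q_of_le le_rfl]
    refine D.rep_q fun h => ?_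
    exact (D.dim_ge_of_mem_region hz).not_gt (D.dim_q_lt h)
  have hlt (m : ℕ) (hm : m < n) :
      ContinuousOn (fun z : P m × Unit => D.rep (D.descent n (D.q ⟨m, z.1⟩) 1))
        {z | D.q ⟨m, z.1⟩ ∈ D.region n} := by
    intro z hz
    exact absurd (D.dim_ge_of_mem_region hz) ((D.dim_q_le _ _).trans_lt hm).not_ge
  induction m with
  | zero =>
    rcases Nat.eq_zero_or_pos n with rfl | hn
    exacts [hself, hlt 0 hn]
  | succ m ih =>
    rcases lt_trichotomy (m + 1) n with hn | rfl | hn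
    · exact hlt _ hn
    · exact hself
    · have h1 := D.continuousOn_L_succ (fun y _ => D.rep (D.descent n y 1)) _ m ih
      obtain ⟨k, rfl⟩ : ∃ k, m = n + k := Nat.exists_eq_add_of_le (Nat.lt_succ_iff.1 hn)
      have h2 : ContinuousOn (fun z : P (n + k + 1) × Unit =>
          D.rep (D.descent n (D.q ⟨n + k + 1, D.H _ (z.1, 1)⟩) 1))
          {z | D.q ⟨n + k + 1, z.1⟩ ∈ D.region n} :=
        h1.comp (f := fun z : P (n + k + 1) × Unit => (D.H (n + k + 1) (z.1, 1), z.2))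
          (by fun_prop) fun z hz =>
            ⟨D.H_one_mem _ _ (D.of_mem_region hn hz).1, (D.of_mem_region hn hz).2⟩
      refine h2.congr fun z hz => ?_
      simp only
      rw [D.descent_q_of_le_mul _ (D.of_mem_region hn hz).1]
      simpa using one_le_pow₀ (M₀ := ℝ) one_le_two

theorem isDoldSpace {B : Type u} [TopologicalSpace B] (hB : IsDoldSpace B) (j : C(B, Y))
    (ρ : C(Σ n, P n, B)) (hρ : D.q.Homotopic (j.comp ρ)) : IsDoldSpace Y := by
  let E (n : ℕ) : C(D.region n, Σ n, P n) := ⟨fun y => D.rep (D.descent n y 1),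
    continuousOn_iff_continuous_domRestrict.1 (D.continuousOn_rep_descent n)⟩
  refine hB.of_countable_cover j (fun n => ⟨D.extWeight n, D.continuous_extWeight n⟩)
    D.extWeight_le_one (fun y => ?_) (fun n => ρ.comp (E n)) fun n => ?_
  · obtain ⟨⟨n, p⟩, hp, rfl⟩ := D.exists_rep' y
    refine ⟨n, ?_⟩
    simp only [ContinuousMap.coe_mk, D.extWeight_q_self]
    exact lt_of_le_of_ne (D.w_nonneg n p) fun h => hp ((D.w_eq_zero n p).1 h.symm)
  · have hc : Continuous fun z : unitInterval × D.region n => D.descent n z.2 z.1 :=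
      (D.continuousOn_descent n).comp_continuous
        (f := fun z : unitInterval × D.region n => ((z.2 : Y), z.1)) (by fun_prop) fun z => z.2.2
    have h1 : (ContinuousMap.mk (Subtype.val : D.region n → Y) continuous_subtype_val).Homotopic
        (D.q.comp (E n)) :=
      ⟨{ toFun := fun z => D.descent n z.2 z.1
         continuous_toFun := hc
         map_zero_left := fun y => D.descent_zero n y
         map_one_left := fun y => (D.q_rep _).symm }⟩
    exact h1.trans (hρ.comp (.refl (E n)))

end SkeletalPresentation

/-! ### Closed cofibrations -/

/-- A retraction of `X × I` onto `X × 0 ∪ A × I`, together with a function measuring the distance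
to `A`. -/
structure CofibrationData (X : Type u) [TopologicalSpace X] (A : Set X) where
  r : C(X × unitInterval, X)
  e : C(X × unitInterval, unitInterval)
  u : C(X, ℝ)
  r_zero : ∀ x, r (x, 0) = x
  e_zero : ∀ x, e (x, 0) = 0
  r_of_mem : ∀ x t, x ∈ A → r (x, t) = x
  e_of_mem : ∀ x t, x ∈ A → e (x, t) = t
  r_mem : ∀ x t, 0 < e (x, t) → r (x, t) ∈ A
  u_nonneg : ∀ x, 0 ≤ u x
  u_le_one : ∀ x, u x ≤ 1
  u_eq_zero : ∀ x, u x = 0 ↔ x ∈ A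
  e_one_pos : ∀ x, u x < 1 → 0 < e (x, 1)

/-- The inclusion of the empty set is a cofibration. -/
def CofibrationData.empty (X : Type u) [TopologicalSpace X] : CofibrationData X ∅ where
  r := .fst
  e := .const _ 0
  u := .const _ 1
  r_zero _ := rfl
  e_zero _ := rfl
  r_of_mem _ _ h := h.elim
  e_of_mem _ _ h := h.elim
  r_mem _ _ h := by simp at h
  u_nonneg _ := by simp
  u_le_one _ := by simp
  u_eq_zero _ := by simp
  e_one_pos _ h := by simp at h

/-- Homotopy extension into `X × 0 ∪ A × I` itself yields a retraction with components `r` and `e`.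
The function `u x = sup_t |t - e (x, t)|` measures distance to `A`: if it vanishes, then `r (x, t) ∈
A` for all `t > 0`, and letting `t → 0` puts `x` in the closed set `A`. -/
theorem IsHurewiczCofibration.nonempty_cofibrationData {X : Type u} [TopologicalSpace X] {A : Set X}
    (hA : IsClosed A) (h : IsHurewiczCofibration
      (ContinuousMap.mk (Subtype.val : A → X) continuous_subtype_val)) :
    Nonempty (CofibrationData X A) := by
  let M : Set (X × unitInterval) := {z | z.2 = 0 ∨ z.1 ∈ A}
  obtain ⟨K, hK0, hKA⟩ := h M ⟨fun x => ⟨(x, 0), Or.inl rfl⟩, by fun_prop⟩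
    ⟨fun z => ⟨(z.1, z.2), Or.inr z.1.2⟩, by fun_prop⟩ fun a => rfl
  let e : C(X × unitInterval, unitInterval) := ⟨fun z => (K z).1.2, by fun_prop⟩
  let r : C(X × unitInterval, X) := ⟨fun z => (K z).1.1, by fun_prop⟩
  have hr0 (x : X) : r (x, 0) = x := by simp [r, hK0]
  have he0 (x : X) : e (x, 0) = 0 := by simp [e, hK0]
  have hrA (x : X) (t) (hx : x ∈ A) : r (x, t) = x := by
    have := hKA ⟨x, hx⟩ t
    simp only [ContinuousMap.coe_mk] at this
    simp [r, this]
  have heA (x : X) (t) (hx : x ∈ A) : e (x, t) = t := by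
    have := hKA ⟨x, hx⟩ t
    simp only [ContinuousMap.coe_mk] at this
    simp [e, this]
  have hrm (x : X) (t) (ht : 0 < e (x, t)) : r (x, t) ∈ A :=
    (K (x, t)).2.resolve_left ht.ne'
  let f (x : X) (t : unitInterval) : ℝ := |(t : ℝ) - e (x, t)|
  have hf1 (x : X) (t : unitInterval) : f x t ≤ 1 := by
    have h1 := t.2
    have h2 := (e (x, t)).2
    exact abs_le.2 ⟨by linarith [h1.1, h2.2], by linarith [h1.2, h2.1]⟩
  have hbdd (x : X) : BddAbove (f x '' univ) :=
    ⟨1, by rintro _ ⟨t, -, rfl⟩; exact hf1 x t⟩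
  have hle (x : X) (t : unitInterval) : f x t ≤ sSup (f x '' univ) :=
    le_csSup (hbdd x) (mem_image_of_mem _ (mem_univ t))
  have hu0 (x : X) : 0 ≤ sSup (f x '' univ) := (abs_nonneg _).trans (hle x 0)
  refine ⟨⟨r, e, ⟨fun x => sSup (f x '' univ), isCompact_univ.continuous_sSup ?_⟩,
    hr0, he0, hrA, heA, hrm, hu0, fun x => ?_, fun x => ⟨fun hx => ?_, fun hx => ?_⟩,
    fun x hx => ?_⟩⟩
  · exact ((continuous_subtype_val.comp continuous_snd).sub
      (continuous_subtype_val.comp e.continuous)).abs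
  · refine csSup_le (univ_nonempty.image _) ?_
    rintro _ ⟨t, -, rfl⟩
    exact hf1 x t
  · have h1 (t : unitInterval) : e (x, t) = t := by
      have h2 : f x t ≤ 0 := (hle x t).trans_eq hx
      have h3 := abs_nonpos_iff.1 h2
      exact Subtype.ext (by linarith)
    have h2 : Tendsto (fun t : unitInterval => r (x, t)) (𝓝[>] 0) (𝓝 x) := by
      have : Continuous fun t : unitInterval => r (x, t) := by fun_prop
      have h3 := this.tendsto 0
      rw [hr0] at h3
      exact h3.mono_left nhdsWithin_le_nhds
    have : (𝓝[>] (0 : unitInterval)).NeBot := nhdsGT_neBot_of_exists_gt ⟨1, zero_lt_one⟩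
    refine hA.mem_of_tendsto h2 (eventually_mem_nhdsWithin.mono fun t ht => hrm x t ?_)
    rw [h1]
    exact ht
  · refine le_antisymm (csSup_le (univ_nonempty.image _) ?_) (hu0 x)
    rintro _ ⟨t, -, rfl⟩
    simp [f, heA x t hx]
  · have h1 : f x 1 < 1 := (hle x 1).trans_lt hx
    have h2 := (abs_lt.1 h1).2
    have h3 : (0 : ℝ) < e (x, 1) := by
      simp only [Set.Icc.coe_one] at h2
      linarith
    exact h3

/-! ### The boundary of the simplex and products of retracts -/

namespace stdSimplex

theorem map_eq_self {ι : Type*} [Fintype ι] {g : ι → ι} {s : stdSimplex ℝ ι}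
    (h : ∀ i, s i ≠ 0 → g i = i) : map g s = s := by
  classical
  ext i
  rw [map_coe, FunOnFinite.linearMap_apply_apply, Finset.sum_filter]
  rw [Finset.sum_eq_single i]
  · split_ifs with hi
    · rfl
    · by_contra h'
      exact hi (h i (Ne.symm h'))
  · intro j _ hj
    split_ifs with hi
    · by_contra h'
      exact hj ((h j h').symm.trans hi)
    · rfl
  · simp

variable {n : ℕ}

/-- The smallest barycentric coordinate. -/
noncomputable def minCoord (s : stdSimplex ℝ (Fin (n + 1))) : ℝ :=
  Finset.univ.inf' Finset.univ_nonempty fun i => s i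

theorem continuous_coord {ι : Type*} [Fintype ι] (i : ι) :
    Continuous fun s : stdSimplex ℝ ι => s i :=
  (continuous_apply i).comp continuous_subtype_val

@[fun_prop]
theorem continuous_minCoord : Continuous (minCoord (n := n)) :=
  Continuous.finset_inf'_apply _ fun i _ => continuous_coord i

theorem minCoord_le (s : stdSimplex ℝ (Fin (n + 1))) (i : Fin (n + 1)) : minCoord s ≤ s i :=
  Finset.inf'_le _ (Finset.mem_univ i)

theorem exists_eq_minCoord (s : stdSimplex ℝ (Fin (n + 1))) : ∃ i, s i = minCoord s := by
  obtain ⟨i, -, hi⟩ := Finset.exists_mem_eq_inf' Finset.univ_nonempty fun i => s i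
  exact ⟨i, hi.symm⟩

theorem minCoord_nonneg (s : stdSimplex ℝ (Fin (n + 1))) : 0 ≤ minCoord s := by
  obtain ⟨i, hi⟩ := exists_eq_minCoord s
  rw [← hi]
  exact s.2.1 i

theorem minCoord_eq_zero {s : stdSimplex ℝ (Fin (n + 1))} : minCoord s = 0 ↔ ∃ i, s i = 0 := by
  constructor
  · intro h
    obtain ⟨i, hi⟩ := exists_eq_minCoord s
    exact ⟨i, hi.trans h⟩
  · rintro ⟨i, hi⟩
    exact le_antisymm (hi ▸ minCoord_le s i) (minCoord_nonneg s)

/-- The depth below the boundary of `Δ^n`, truncated at `t`. -/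
noncomputable def depth (n : ℕ) :
    C(stdSimplex ℝ (Fin (n + 1)) × unitInterval, unitInterval) :=
  ⟨fun z => ⟨min z.2 (2 * (n + 1) * minCoord z.1), by
    have := minCoord_nonneg z.1
    exact ⟨le_min z.2.2.1 (by positivity), (min_le_left _ _).trans z.2.2.2⟩⟩, by fun_prop⟩

theorem coe_depth (s : stdSimplex ℝ (Fin (n + 1))) (t : unitInterval) :
    (depth n (s, t) : ℝ) = min (t : ℝ) (2 * (n + 1) * minCoord s) := rfl

theorem depth_zero (s : stdSimplex ℝ (Fin (n + 1))) : depth n (s, 0) = 0 := by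
  ext
  have := minCoord_nonneg s
  rw [coe_depth, Set.Icc.coe_zero, min_eq_left (by positivity)]

theorem depth_of_eq_zero {s : stdSimplex ℝ (Fin (n + 1))} (h : ∃ i, s i = 0) (t : unitInterval) :
    depth n (s, t) = 0 := by
  ext
  rw [coe_depth, minCoord_eq_zero.2 h, mul_zero, Set.Icc.coe_zero, min_eq_right t.2.1]

/-- Radial expansion from the barycenter of `Δ^n`. -/
noncomputable def expand (n : ℕ) : C({z : stdSimplex ℝ (Fin (n + 1)) × ℝ //
    z.2 ≤ minCoord z.1 ∧ 2 * (n + 1) * z.2 ≤ 1}, stdSimplex ℝ (Fin (n + 1))) where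
  -- The bound on the parameter keeps the denominator at least `1 / 2`. Negative parameters are
  -- allowed, since `depth - e` can be negative.
  toFun z := ⟨fun i => (z.1.1 i - z.1.2) / (1 - (n + 1) * z.1.2), by
    have h1 : 0 < 1 - (n + 1) * z.1.2 := by linarith [z.2.2]
    refine ⟨fun i => div_nonneg ?_ h1.le, ?_⟩
    · linarith [z.2.1, minCoord_le z.1.1 i]
    · rw [← Finset.sum_div, Finset.sum_sub_distrib, stdSimplex.sum_eq_one]
      simpa using div_self h1.ne'⟩
  continuous_toFun := by
    refine Continuous.subtype_mk (continuous_pi fun i => Continuous.div ?_ ?_ fun z => ?_) _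
    · exact ((continuous_coord i).comp (by fun_prop)).sub (by fun_prop)
    · fun_prop
    · have h1 : 0 < 1 - (n + 1) * z.1.2 := by linarith [z.2.2]
      exact h1.ne'

theorem expand_zero (s : stdSimplex ℝ (Fin (n + 1))) (h) : expand n ⟨(s, 0), h⟩ = s := by
  refine Subtype.ext (funext fun i => ?_)
  simp only [expand, ContinuousMap.coe_mk, mul_zero, sub_zero, div_one]
  rfl

theorem exists_expand_eq_zero (s : stdSimplex ℝ (Fin (n + 1))) (h) :
    ∃ i, expand n ⟨(s, minCoord s), h⟩ i = 0 := by
  obtain ⟨i, hi⟩ := exists_eq_minCoord s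
  refine ⟨i, ?_⟩
  change (s i - minCoord s) / _ = 0
  simp [hi]

end stdSimplex

namespace CofibrationData

variable {X : Type u} [TopologicalSpace X] {A : Set X} (c : CofibrationData X A) (n : ℕ)

/-- The homotopy deforming a neighbourhood of `A × Δ^n ∪ X × ∂Δ^n` in `X × Δ^n` into it. -/
noncomputable def prodHomotopy :
    C((X × stdSimplex ℝ (Fin (n + 1))) × unitInterval, X × stdSimplex ℝ (Fin (n + 1))) where
  -- Only `depth` units of time are spent in `X`, and the shortfall `depth - e` is spent expanding
  -- the simplex. On `A` the shortfall is zero; on `∂Δ^n` the depth is zero.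
  toFun z := (c.r (z.1.1, stdSimplex.depth n (z.1.2, z.2)),
    stdSimplex.expand n ⟨(z.1.2, ((stdSimplex.depth n (z.1.2, z.2) : ℝ) -
      c.e (z.1.1, stdSimplex.depth n (z.1.2, z.2))) / (2 * (n + 1))), by
      have h1 := (c.e (z.1.1, stdSimplex.depth n (z.1.2, z.2))).2.1
      have h2 : (0 : ℝ) < 2 * (n + 1) := by positivity
      constructor
      · rw [div_le_iff₀ h2, mul_comm]
        have := min_le_right (z.2 : ℝ) (2 * (n + 1) * stdSimplex.minCoord z.1.2)
        rw [← stdSimplex.coe_depth] at this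
        linarith
      · rw [mul_div_cancel₀ _ h2.ne']
        linarith [(stdSimplex.depth n (z.1.2, z.2)).2.2]⟩)
  continuous_toFun := by fun_prop

/-- The distance from `A × Δ^n ∪ X × ∂Δ^n` in `X × Δ^n`. -/
noncomputable def prodDist : C(X × stdSimplex ℝ (Fin (n + 1)), ℝ) :=
  ⟨fun z => min (min 1 (2 * (n + 1) * stdSimplex.minCoord z.2)) (c.u z.1), by fun_prop⟩

theorem prodDist_nonneg (z) : 0 ≤ c.prodDist n z := by
  have := stdSimplex.minCoord_nonneg z.2
  exact le_min (le_min zero_le_one (by positivity)) (c.u_nonneg _)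

theorem prodDist_le_one (z) : c.prodDist n z ≤ 1 := (min_le_right _ _).trans (c.u_le_one _)

theorem prodDist_eq_zero (z) : c.prodDist n z = 0 ↔ z.1 ∈ A ∨ ∃ i, z.2 i = 0 := by
  have h1 := stdSimplex.minCoord_nonneg z.2
  have h2 := c.u_nonneg z.1
  have h3 : (0 : ℝ) < 2 * (n + 1) := by positivity
  rw [← c.u_eq_zero, ← stdSimplex.minCoord_eq_zero]
  change min (min 1 (2 * (n + 1) * stdSimplex.minCoord z.2)) (c.u z.1) = 0 ↔ _
  constructor
  · intro h
    rcases min_choice (min 1 (2 * (n + 1) * stdSimplex.minCoord z.2)) (c.u z.1) with h' | h' <;>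
      rw [h'] at h
    · rcases min_choice 1 (2 * (n + 1) * stdSimplex.minCoord z.2) with h' | h' <;> rw [h'] at h
      · exact absurd h one_ne_zero
      · exact Or.inr ((mul_eq_zero.1 h).resolve_left h3.ne')
    · exact Or.inl h
  · rintro (h | h)
    · rw [h, min_eq_right (le_min zero_le_one (by positivity))]
    · rw [h, mul_zero, min_eq_right zero_le_one, min_eq_left h2]

theorem prodHomotopy_zero (z) : c.prodHomotopy n (z, 0) = z := by
  simp [prodHomotopy, stdSimplex.depth_zero, c.r_zero, c.e_zero, stdSimplex.expand_zero]

theorem prodHomotopy_of_mem (z t) (h : z.1 ∈ A ∨ ∃ i, z.2 i = 0) :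
    c.prodHomotopy n (z, t) = z := by
  rcases h with h | h
  · simp [prodHomotopy, c.r_of_mem _ _ h, c.e_of_mem _ _ h, stdSimplex.expand_zero]
  · simp [prodHomotopy, stdSimplex.depth_of_eq_zero h, c.r_zero, c.e_zero, stdSimplex.expand_zero]

/-- If `e > 0`, the first component is in `A`. If `e = 0` and the depth is not truncated, the
expansion parameter is `minCoord`, which reaches the boundary. If it is truncated to `1`, then `e
(x, 1) = 0` forces `u x = 1`, contradicting the hypothesis. -/
theorem prodHomotopy_one_mem (z) (h : c.prodDist n z < 1) :
    (c.prodHomotopy n (z, 1)).1 ∈ A ∨ ∃ i, (c.prodHomotopy n (z, 1)).2 i = 0 := by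
  by_cases he : 0 < c.e (z.1, stdSimplex.depth n (z.2, 1))
  · exact Or.inl (c.r_mem _ _ he)
  right
  have he0 : c.e (z.1, stdSimplex.depth n (z.2, 1)) = 0 :=
    le_antisymm (not_lt.1 he) (c.e (z.1, stdSimplex.depth n (z.2, 1))).2.1
  have h2 : (0 : ℝ) < 2 * (n + 1) := by positivity
  have h3 : 2 * (n + 1) * stdSimplex.minCoord z.2 < 1 := by
    by_contra! h3
    have hd : stdSimplex.depth n (z.2, 1) = 1 := by
      ext
      rw [stdSimplex.coe_depth, Set.Icc.coe_one, min_eq_left h3]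
    rw [hd] at he
    refine he (c.e_one_pos _ (lt_of_not_ge fun h4 => h.not_ge ?_))
    exact le_min (le_min le_rfl h3) h4
  have hd : (stdSimplex.depth n (z.2, 1) : ℝ) = 2 * (n + 1) * stdSimplex.minCoord z.2 := by
    rw [stdSimplex.coe_depth, Set.Icc.coe_one, min_eq_right h3.le]
  have h4 : ((stdSimplex.depth n (z.2, 1) : ℝ) -
      c.e (z.1, stdSimplex.depth n (z.2, 1))) / (2 * (n + 1)) = stdSimplex.minCoord z.2 := by
    rw [he0, hd, Set.Icc.coe_zero, sub_zero, mul_div_cancel_left₀ _ h2.ne']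
  have h5 : (c.prodHomotopy n (z, 1)).2 =
      stdSimplex.expand n ⟨(z.2, stdSimplex.minCoord z.2), le_rfl, h3.le⟩ := by
    simp only [prodHomotopy, ContinuousMap.coe_mk, h4]
  rw [h5]
  exact stdSimplex.exists_expand_eq_zero z.2 _

end CofibrationData

/-! ### Realizations as skeletal presentations -/

/-- A presentation of `Y` as a realization: a quotient of `∐ n, Z n × Δ^n` in which points whose
first component lies in `A n` or whose second component lies in `∂Δ^n` are identified with points
of lower dimension. -/
structure SimplicialPresentation (Z : ℕ → Type u) [∀ n, TopologicalSpace (Z n)] (Y : Type u)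
    [TopologicalSpace Y] where
  q : C(Σ n, Z n × stdSimplex ℝ (Fin (n + 1)), Y)
  isQuotientMap : IsQuotientMap q
  A : ∀ n, Set (Z n)
  A_zero : A 0 = ∅
  cof : ∀ n, CofibrationData (Z n) (A n)
  B : ∀ n, Fin (n + 1) → Set (Z (n + 1))
  isClosed_B : ∀ n i, IsClosed (B n i)
  A_succ : ∀ n, A (n + 1) = ⋃ i, B n i
  d : ∀ n, Fin (n + 2) → C(Z (n + 1), Z n)
  q_d : ∀ n i x s, q ⟨n + 1, x, stdSimplex.map (Fin.succAbove i) s⟩ = q ⟨n, d n i x, s⟩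
  q_of_mem_B : ∀ n i x s, x ∈ B n i →
    q ⟨n + 1, x, s⟩ = q ⟨n, d n i.castSucc x, stdSimplex.map (Fin.predAbove i) s⟩
  eq_of_q_eq : ∀ x y : Σ n, Z n × stdSimplex ℝ (Fin (n + 1)), x.2.1 ∉ A x.1 → (∀ i, x.2.2 i ≠ 0) →
    y.2.1 ∉ A y.1 → (∀ i, y.2.2 i ≠ 0) → q x = q y → x = y
  v : ∀ n, C(Z n, Z 0)
  q_v : ∀ n x, q ⟨n, x, stdSimplex.vertex 0⟩ = q ⟨0, v n x, stdSimplex.vertex 0⟩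

namespace SimplicialPresentation

variable {Z : ℕ → Type u} [∀ n, TopologicalSpace (Z n)] {Y : Type u} [TopologicalSpace Y]
  (D : SimplicialPresentation Z Y)

/-- The associated skeletal presentation. -/
noncomputable def toSkeletalPresentation :
    SkeletalPresentation (fun n => Z n × stdSimplex ℝ (Fin (n + 1))) Y where
  q := D.q
  isQuotientMap := D.isQuotientMap
  L n := {z | z.1 ∈ D.A n ∨ ∃ i, z.2 i = 0}
  L_zero := by
    ext z
    simp [D.A_zero]
  J n := Fin (n + 1) ⊕ Fin (n + 2)
  finite_J n := inferInstance
  C n := Sum.elim (fun i => {z | z.1 ∈ D.B n i}) (fun i => {z | z.2 i = 0})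
  isClosed_C n j := by
    rcases j with i | i
    · exact (D.isClosed_B n i).preimage continuous_fst
    · exact isClosed_eq ((stdSimplex.continuous_coord i).comp continuous_snd) continuous_const
  -- The face `d n i.castSucc` undoes the `i`-th degeneracy. On the facet where coordinate `i`
  -- vanishes, `invFun` inverts `Fin.succAbove i`; its arbitrary value at `i` carries no mass.
  c n := Sum.elim
    (fun i => ((D.d n i.castSucc).prodMap ⟨_, stdSimplex.continuous_map (Fin.predAbove i)⟩))
    (fun i => ((D.d n i).prodMap ⟨_, stdSimplex.continuous_map (invFun (Fin.succAbove i))⟩))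
  L_succ n := by
    ext z
    simp [D.A_succ]
  q_c n j p hp := by
    rcases j with i | i
    · exact D.q_of_mem_B n i p.1 p.2 hp
    · change _ = D.q ⟨n, D.d n i p.1, stdSimplex.map (invFun (Fin.succAbove i)) p.2⟩
      rw [← D.q_d, stdSimplex.map_comp_apply, stdSimplex.map_eq_self]
      intro k hk
      have hki : k ≠ i := by
        rintro rfl
        exact hk hp
      exact invFun_eq (Fin.exists_succAbove_eq hki)
  eq_of_q_eq x y hx hy h := by
    simp only [mem_ofPred_eq, not_or, not_exists] at hx hy
    exact D.eq_of_q_eq x y hx.1 hx.2 hy.1 hy.2 h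
  w n := (D.cof n).prodDist n
  w_nonneg n := (D.cof n).prodDist_nonneg n
  w_le_one n := (D.cof n).prodDist_le_one n
  w_eq_zero n := (D.cof n).prodDist_eq_zero n
  H n := (D.cof n).prodHomotopy n
  H_zero n := (D.cof n).prodHomotopy_zero n
  H_of_mem n := (D.cof n).prodHomotopy_of_mem n
  H_one_mem n := (D.cof n).prodHomotopy_one_mem n

/-- The straight-line contraction of each simplex to vertex `0` is a homotopy from `q` to a map
through `Z 0`. -/
theorem isDoldSpace (D : SimplicialPresentation Z Y) (h : IsDoldSpace (Z 0)) : IsDoldSpace Y := by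
  let j : C(Z 0, Y) := ⟨fun x => D.q ⟨0, x, stdSimplex.vertex 0⟩,
    D.q.continuous.comp (continuous_sigmaMk.comp (by fun_prop))⟩
  let ρ : C(Σ n, Z n × stdSimplex ℝ (Fin (n + 1)), Z 0) :=
    ⟨fun z => D.v z.1 z.2.1, continuous_sigma fun n => (D.v n).continuous.comp continuous_fst⟩
  let γ (n : ℕ) (t : unitInterval) (s : stdSimplex ℝ (Fin (n + 1))) : stdSimplex ℝ (Fin (n + 1)) :=
    ⟨(1 - t : ℝ) • s.1 + (t : ℝ) • (stdSimplex.vertex (S := ℝ) (0 : Fin (n + 1))).1,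
      convex_stdSimplex ℝ _ s.2 (stdSimplex.vertex (S := ℝ) (0 : Fin (n + 1))).2
        (by linarith [t.2.2]) t.2.1 (by ring)⟩
  have hγ (n : ℕ) : Continuous fun z : unitInterval × stdSimplex ℝ (Fin (n + 1)) => γ n z.1 z.2 :=
    Continuous.subtype_mk (by fun_prop) _
  have hc : Continuous fun z : unitInterval × (Σ n, Z n × stdSimplex ℝ (Fin (n + 1))) =>
      D.q ⟨z.2.1, z.2.2.1, γ z.2.1 z.1 z.2.2.2⟩ := by
    rw [continuous_iff_continuousAt]
    rintro ⟨t, n, x, s⟩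
    have hn : IsOpenEmbedding
        (@Sigma.mk ℕ (fun n => Z n × stdSimplex ℝ (Fin (n + 1))) n) := IsOpenEmbedding.sigmaMk
    have he := (IsOpenEmbedding.id (X := unitInterval)).prodMap hn
    refine (he.continuousAt_iff (x := (t, x, s))).1 (Continuous.continuousAt ?_)
    change Continuous fun z : unitInterval × (Z n × stdSimplex ℝ (Fin (n + 1))) =>
      D.q ⟨n, z.2.1, γ n z.1 z.2.2⟩
    have := (hγ n).comp (f := fun z : unitInterval × (Z n × stdSimplex ℝ (Fin (n + 1))) =>
      (z.1, z.2.2)) (by fun_prop)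
    exact D.q.continuous.comp (continuous_sigmaMk.comp
      ((continuous_fst.comp continuous_snd).prodMk this))
  refine D.toSkeletalPresentation.isDoldSpace h j ρ
    ⟨{ toFun := _, continuous_toFun := hc, map_zero_left := ?_, map_one_left := ?_ }⟩
  · rintro ⟨n, x, s⟩
    have : γ n 0 s = s := Subtype.ext (by simp [γ])
    simp only [this]
    rfl
  · rintro ⟨n, x, s⟩
    have : γ n 1 s = stdSimplex.vertex 0 := Subtype.ext (by simp [γ])
    simp only [this]
    exact D.q_v n x

end SimplicialPresentation

/-! ### Normal forms in quotients and supports in simplices -/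

/-- Transport along `r` in one direction is enough: existence and uniqueness supply the converse, so
the set of normal forms descends to the quotient. -/
theorem Quot.eq_of_normalForm {α β : Type*} {r : α → α → Prop} (N : α → β → Prop)
    (hr : ∀ a a' b, r a a' → N a b → N a' b) (hex : ∀ a, ∃ b, N a b)
    (huniq : ∀ a b b', N a b → N a b' → b = b') {a a' : α} {b b' : β} (h : N a b) (h' : N a' b')
    (haa' : Quot.mk r a = Quot.mk r a') : b = b' := by
  have hN (a a' : α) (haa' : r a a') : N a = N a' := by
    ext b
    refine ⟨hr a a' b haa', fun hb => ?_⟩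
    obtain ⟨c, hc⟩ := hex a
    exact huniq a' _ _ (hr a a' c haa' hc) hb ▸ hc
  have : N a = N a' := congrArg (Quot.lift N hN) haa'
  exact huniq a' b b' (this ▸ h) h'

theorem isQuotientMap_quotMk_sigma {I : Type*} {P : I → Type u} [∀ i, TopologicalSpace (P i)]
    (f : ℕ ≃ I) (r : (Σ i, P i) → (Σ i, P i) → Prop) :
    IsQuotientMap fun z : Σ n, P (f n) => Quot.mk r ⟨f z.1, z.2⟩ := by
  have h1 : IsQuotientMap fun z : Σ n, P (f n) => (⟨f z.1, z.2⟩ : Σ i, P i) := by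
    refine IsOpenMap.isQuotientMap (isOpenMap_sigma.2 fun n => isOpenMap_sigmaMk)
      (continuous_sigma fun n => continuous_sigmaMk) fun ⟨i, p⟩ => ?_
    obtain ⟨n, rfl⟩ := f.surjective i
    exact ⟨⟨n, p⟩, rfl⟩
  exact isQuotientMap_quot_mk.comp h1

namespace stdSimplex

theorem map_apply_ne_zero_iff {ι κ : Type*} [Fintype ι] [Fintype κ] {f : ι → κ}
    {s : stdSimplex ℝ ι} {k : κ} : map f s k ≠ 0 ↔ ∃ i, f i = k ∧ s i ≠ 0 := by
  classical
  rw [map_coe, FunOnFinite.linearMap_apply_apply, ne_eq, Finset.sum_eq_zero_iff_of_nonneg]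
  · simp
  · exact fun i _ => s.2.1 i

theorem map_apply_of_injective {ι κ : Type*} [Fintype ι] [Fintype κ] {f : ι → κ}
    (hf : Injective f) (s : stdSimplex ℝ ι) (i : ι) : map f s (f i) = s i := by
  classical
  rw [map_coe, FunOnFinite.linearMap_apply_apply, Finset.sum_filter, Finset.sum_eq_single i]
  · simp
  · intro j _ hj
    simp [hf.ne hj]
  · simp

theorem exists_support_embedding {n : ℕ} (s : stdSimplex ℝ (Fin (n + 1))) :
    ∃ (k : ℕ) (f : Fin (k + 1) ↪o Fin (n + 1)) (t : stdSimplex ℝ (Fin (k + 1))),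
      (∀ i, t i ≠ 0) ∧ map f t = s := by
  classical
  let S : Finset (Fin (n + 1)) := {i | s i ≠ 0}
  have hS : S.Nonempty := by
    by_contra h
    rw [Finset.not_nonempty_iff_eq_empty, Finset.filter_eq_empty_iff] at h
    have h1 : ∑ i, s i = 0 := Finset.sum_eq_zero fun i _ => not_not.1 (h (Finset.mem_univ i))
    rw [sum_eq_one] at h1
    exact one_ne_zero h1
  obtain ⟨k, hk⟩ : ∃ k, S.card = k + 1 := Nat.exists_eq_succ_of_ne_zero hS.card_pos.ne'
  let f := S.orderEmbOfFin hk
  have hf : Set.range f = S := S.range_orderEmbOfFin hk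
  have hsum : ∑ i, s (f i) = 1 := by
    rw [← s.2.2, ← Finset.sum_image (f := fun i => s i) (g := f) (s := Finset.univ)
      f.injective.injOn]
    refine Finset.sum_subset (Finset.subset_univ _) fun i _ hi => ?_
    by_contra h
    have h1 : i ∈ Set.range f := hf ▸ (by simpa [S] using h)
    obtain ⟨j, rfl⟩ := h1
    exact hi (Finset.mem_image_of_mem _ (Finset.mem_univ j))
  let t : stdSimplex ℝ (Fin (k + 1)) := ⟨fun i => s (f i), fun i => s.2.1 _, hsum⟩
  have ht (i) : t i = s (f i) := rfl
  refine ⟨k, f, t, fun i => ?_, ?_⟩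
  · have h1 : f i ∈ S := S.orderEmbOfFin_mem hk i
    rw [ht]
    exact (Finset.mem_filter.1 h1).2
  · refine Subtype.ext (funext fun i => ?_)
    change map f t i = s i
    by_cases hi : s i = 0
    · rw [hi]
      by_contra h
      obtain ⟨j, rfl, hj⟩ := map_apply_ne_zero_iff.1 h
      exact hj hi
    · have h1 : i ∈ Set.range f := hf ▸ (by simpa [S] using hi)
      obtain ⟨j, rfl⟩ := h1
      exact map_apply_of_injective f.injective t j

/-- The range of `f` is the support of the image point, which determines `k` and `f`; then `t` is
read off as coordinates. -/
theorem support_embedding_unique {n k k' : ℕ} {f : Fin (k + 1) ↪o Fin (n + 1)}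
    {f' : Fin (k' + 1) ↪o Fin (n + 1)} {t : stdSimplex ℝ (Fin (k + 1))}
    {t' : stdSimplex ℝ (Fin (k' + 1))} (ht : ∀ i, t i ≠ 0) (ht' : ∀ i, t' i ≠ 0)
    (h : map f t = map f' t') :
    (⟨k, f, t⟩ : Σ k, (Fin (k + 1) ↪o Fin (n + 1)) × stdSimplex ℝ (Fin (k + 1))) = ⟨k', f', t'⟩ := by
  have hrange {k : ℕ} {f : Fin (k + 1) ↪o Fin (n + 1)} {t : stdSimplex ℝ (Fin (k + 1))}
      (ht : ∀ i, t i ≠ 0) : Set.range f = {i | map f t i ≠ 0} := by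
    ext i
    rw [mem_ofPred_eq, map_apply_ne_zero_iff]
    exact exists_congr fun j => (and_iff_left (ht j)).symm
  have hr : Set.range f = Set.range f' := by rw [hrange ht, hrange ht', h]
  obtain rfl : k = k' := by
    have h1 := congrArg Set.ncard hr
    rw [← Set.image_univ, ← Set.image_univ, Set.ncard_image_of_injective _ f.injective,
      Set.ncard_image_of_injective _ f'.injective] at h1
    simpa using h1
  obtain rfl : f = f' := OrderEmbedding.range_inj.1 hr
  obtain rfl : t = t' := by
    refine Subtype.ext (funext fun i => ?_)
    change t i = t' i
    rw [← map_apply_of_injective f.injective t, h, map_apply_of_injective f.injective]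
  rfl

end stdSimplex

/-! ### The fat realization -/

namespace SemiSimplexCategory

/-- The bijection between natural numbers and objects. -/
def natEquiv : ℕ ≃ SemiSimplexCategory := ⟨mk, len, fun _ => rfl, fun _ => rfl⟩

/-- The morphism to the first vertex. -/
def zeroVertex (n : ℕ) : ⦋0⦌ₛ ⟶ ⦋n⦌ₛ :=
  homEquiv.symm (OrderEmbedding.ofStrictMono (fun _ : Fin 1 => (0 : Fin (n + 1)))
    (Subsingleton.strictMono (α := Fin 1) _))

/-- The `i`-th face map. -/
def face {n : ℕ} (i : Fin (n + 2)) : ⦋n⦌ₛ ⟶ ⦋n + 1⦌ₛ := homEquiv.symm (Fin.succAboveOrderEmb i)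

end SemiSimplexCategory

namespace SemisimplicialSpace

variable (X : SemisimplicialSpace.{u})

theorem map_comp_apply {a b c : SemiSimplexCategory} (f : a ⟶ b) (g : b ⟶ c) (x : X.obj (op c)) :
    X.map (f ≫ g).op x = X.map f.op (X.map g.op x) := by
  rw [op_comp, X.map_comp]
  rfl

/-- The quotient map onto the fat realization. -/
def toFat : C(Σ n : ℕ, X.obj (op ⦋n⦌ₛ) × stdSimplex ℝ (Fin (n + 1)), FatRealization X) :=
  ⟨fun z => Quot.mk _ ⟨⦋z.1⦌ₛ, z.2⟩, (isQuotientMap_quotMk_sigma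
    (P := fun n => X.obj (op n) × stdSimplex ℝ (Fin (n.len + 1)))
    SemiSimplexCategory.natEquiv _).continuous⟩

theorem isQuotientMap_toFat : IsQuotientMap X.toFat :=
  isQuotientMap_quotMk_sigma (P := fun n => X.obj (op n) × stdSimplex ℝ (Fin (n.len + 1)))
    SemiSimplexCategory.natEquiv _

theorem toFat_map {m n : ℕ} (f : ⦋m⦌ₛ ⟶ ⦋n⦌ₛ) (x : X.obj (op ⦋n⦌ₛ))
    (s : stdSimplex ℝ (Fin (m + 1))) :
    X.toFat ⟨m, X.map f.op x, s⟩ =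
      X.toFat ⟨n, x, stdSimplex.map (SemiSimplexCategory.homEquiv f) s⟩ :=
  Quot.sound (.glue f x s)

/-- `b` is the restriction of `a` to the face of the simplex on which it is supported. -/
def IsNormalForm (a : Σ n : SemiSimplexCategory, X.obj (op n) × stdSimplex ℝ (Fin (n.len + 1)))
    (b : Σ n : ℕ, X.obj (op ⦋n⦌ₛ) × stdSimplex ℝ (Fin (n + 1))) : Prop :=
  ∃ f : ⦋b.1⦌ₛ ⟶ a.1, X.map f.op a.2.1 = b.2.1 ∧
    stdSimplex.map (SemiSimplexCategory.homEquiv f) b.2.2 = a.2.2 ∧ ∀ i, b.2.2 i ≠ 0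

theorem isNormalForm_self {b : Σ n : ℕ, X.obj (op ⦋n⦌ₛ) × stdSimplex ℝ (Fin (n + 1))}
    (hb : ∀ i, b.2.2 i ≠ 0) : X.IsNormalForm ⟨⦋b.1⦌ₛ, b.2⟩ b :=
  ⟨𝟙 _, by simp, stdSimplex.map_eq_self fun _ _ => rfl, hb⟩

theorem IsNormalForm.of_rel {a a' b} (h : FatRealizationRel X a a') (hb : X.IsNormalForm a b) :
    X.IsNormalForm a' b := by
  obtain ⟨f, x, s⟩ := h
  obtain ⟨g, hg1, hg2, hg3⟩ := hb
  dsimp only at g hg1 hg2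
  refine ⟨g ≫ f, ?_, ?_, hg3⟩
  · rw [← hg1, map_comp_apply]
  · dsimp only
    rw [← hg2, stdSimplex.map_comp_apply]
    rfl

theorem exists_isNormalForm (a) : ∃ b, X.IsNormalForm a b := by
  obtain ⟨n, x, s⟩ := a
  obtain ⟨k, f, t, ht, hts⟩ := stdSimplex.exists_support_embedding s
  let g : ⦋k⦌ₛ ⟶ n := SemiSimplexCategory.homEquiv.symm f
  exact ⟨⟨k, X.map g.op x, t⟩, g, rfl, hts, ht⟩

theorem IsNormalForm.unique {a b b'} (h : X.IsNormalForm a b) (h' : X.IsNormalForm a b') :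
    b = b' := by
  obtain ⟨n, x, s⟩ := a
  obtain ⟨k, y, t⟩ := b
  obtain ⟨k', y', t'⟩ := b'
  obtain ⟨f, hf1, hf2, hf3⟩ := h
  obtain ⟨f', hf1', hf2', hf3'⟩ := h'
  dsimp only at f f' hf1 hf2 hf3 hf1' hf2' hf3'
  have := stdSimplex.support_embedding_unique hf3 hf3' (hf2.trans hf2'.symm)
  simp only [Sigma.mk.injEq] at this
  obtain ⟨rfl, h2⟩ := this
  simp only [heq_eq_eq, Prod.mk.injEq, EmbeddingLike.apply_eq_iff_eq] at h2
  obtain ⟨rfl, rfl⟩ := h2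
  rw [← hf1, ← hf1']

/-- The fat realization as a realization with empty degenerate parts. -/
noncomputable def fatPresentation :
    SimplicialPresentation (fun n => X.obj (op ⦋n⦌ₛ)) (FatRealization X) where
  q := X.toFat
  isQuotientMap := X.isQuotientMap_toFat
  A _ := ∅
  A_zero := rfl
  cof n := .empty _
  B _ _ := ∅
  isClosed_B _ _ := isClosed_empty
  A_succ _ := by simp
  d n i := (X.map (SemiSimplexCategory.face i).op).hom
  q_d n i x s := (X.toFat_map (SemiSimplexCategory.face i) x s).symm
  q_of_mem_B _ _ _ _ h := h.elim
  eq_of_q_eq a b _ ha _ hb h :=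
    Quot.eq_of_normalForm X.IsNormalForm (fun _ _ _ => IsNormalForm.of_rel X)
      X.exists_isNormalForm (fun _ _ _ => IsNormalForm.unique X)
      (X.isNormalForm_self ha) (X.isNormalForm_self hb) h
  v n := (X.map (SemiSimplexCategory.zeroVertex n).op).hom
  q_v n x := by
    refine Eq.trans ?_ (X.toFat_map (SemiSimplexCategory.zeroVertex n) x (stdSimplex.vertex 0)).symm
    rw [stdSimplex.map_vertex]
    rfl

end SemisimplicialSpace

/-! ### The ordinary realization -/

namespace SimplicialSpace

variable (X : SimplicialSpace.{u})

theorem map_comp_apply {a b c : SimplexCategory} (f : a ⟶ b) (g : b ⟶ c) (x : X.obj (op c)) :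
    X.map (f ≫ g).op x = X.map f.op (X.map g.op x) := by
  rw [op_comp, X.map_comp]
  rfl

/-- The underlying simplicial set. -/
abbrev toSSet : SSet.{u} := X ⋙ CategoryTheory.forget TopCat

/-- The Eilenberg–Zilber lemma for the underlying simplicial set. -/
theorem exists_nonDegenerate {n : ℕ} (x : X.obj (op ⦋n⦌)) :
    ∃ (m : ℕ) (f : ⦋n⦌ ⟶ ⦋m⦌) (y : X.obj (op ⦋m⦌)),
      Epi f ∧ y ∉ degenerateElements X m ∧ x = X.map f.op y := by
  obtain ⟨m, f, hf, ⟨y, hy⟩, h⟩ := X.toSSet.exists_nonDegenerate x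
  exact ⟨m, f, y, hf, hy, h⟩

theorem nonDegenerate_unique {n m m' : ℕ} {f : ⦋n⦌ ⟶ ⦋m⦌} {f' : ⦋n⦌ ⟶ ⦋m'⦌} [Epi f] [Epi f']
    {y : X.obj (op ⦋m⦌)} {y' : X.obj (op ⦋m'⦌)} (hy : y ∉ degenerateElements X m)
    (hy' : y' ∉ degenerateElements X m') (h : X.map f.op y = X.map f'.op y') :
    (⟨m, f, y⟩ : Σ m : ℕ, (⦋n⦌ ⟶ ⦋m⦌) × X.obj (op ⦋m⦌)) = ⟨m', f', y'⟩ := by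
  let z : X.toSSet.nonDegenerate m := ⟨y, hy⟩
  let z' : X.toSSet.nonDegenerate m' := ⟨y', hy'⟩
  obtain rfl := X.toSSet.unique_nonDegenerate_dim (X.map f.op y) f z rfl f' z' h
  have h1 : z = z' := X.toSSet.unique_nonDegenerate_simplex (X.map f.op y) f z rfl f' z' h
  have h2 : f = f' := X.toSSet.unique_nonDegenerate_map (X.map f.op y) f z rfl f' z' h
  have h3 : y = y' := congrArg Subtype.val h1
  rw [h2, h3]

theorem degenerateElements_succ (n : ℕ) :
    degenerateElements X (n + 1) =
      ⋃ i : Fin (n + 1), Set.range (X.map (SimplexCategory.σ i).op) :=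
  X.toSSet.degenerate_eq_iUnion_range_σ

theorem map_mem_degenerateElements {m n : ℕ} (f : ⦋m⦌ ⟶ ⦋n⦌) (hf : ¬ Function.Injective f.toOrderHom)
    (x : X.obj (op ⦋n⦌)) : X.map f.op x ∈ degenerateElements X m := by
  by_contra h
  have := X.toSSet.mono_of_nonDegenerate ⟨X.map f.op x, h⟩ f x rfl
  exact hf (SimplexCategory.mono_iff_injective.1 this)

/-- Only the union of the ranges is assumed closed. Write a limit point as `f^* y` with `y`
nondegenerate. If `f` separates `i` and `i + 1`, some section `g` of `f` hits both, so `g^*` sends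
the range of `σ i`, hence its closure, into degenerate elements, yet it sends the limit point to
`y`. -/
theorem isClosed_range_degeneracy (hX : ∀ n, IsClosed (degenerateElements X n)) {n : ℕ}
    (i : Fin (n + 1)) : IsClosed (Set.range (X.map (SimplexCategory.σ i).op)) := by
  refine isClosed_of_closure_subset fun x hx => ?_
  obtain ⟨m, f, y, hf, hy, rfl⟩ := X.exists_nonDegenerate x
  by_cases hi : f.toOrderHom i.castSucc = f.toOrderHom i.succ
  · obtain ⟨g, rfl⟩ := SimplexCategory.eq_σ_comp_of_not_injective' f i hi
    exact ⟨X.map g.op y, (X.map_comp_apply _ _ _).symm⟩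
  exfalso
  have hsurj : Surjective f.toOrderHom := SimplexCategory.epi_iff_surjective.1 hf
  let α (j : Fin (m + 1)) : Fin (n + 2) :=
    if j = f.toOrderHom i.castSucc then i.castSucc
    else if j = f.toOrderHom i.succ then i.succ else surjInv hsurj j
  have hα (j : Fin (m + 1)) : f.toOrderHom (α j) = j := by
    simp only [α]
    split_ifs with h1 h2
    exacts [h1.symm, h2.symm, surjInv_eq hsurj j]
  -- Any section of a monotone map between linear orders is monotone.
  have hαm : Monotone α := by
    intro j k hjk
    by_contra! h
    have h1 := f.toOrderHom.monotone h.le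
    rw [hα, hα] at h1
    exact h.ne' (by rw [le_antisymm hjk h1])
  let g : ⦋m⦌ ⟶ ⦋n + 1⦌ := SimplexCategory.Hom.mk ⟨α, hαm⟩
  have hgf : g ≫ f = 𝟙 _ := by
    ext j : 3
    exact hα j
  have hy1 : X.map g.op (X.map f.op y) = y := by
    rw [← map_comp_apply, hgf]
    simp
  have hsub : Set.range (X.map (SimplexCategory.σ i).op) ⊆
      (X.map g.op) ⁻¹' (degenerateElements X m) := by
    rintro _ ⟨z, rfl⟩
    rw [mem_preimage, ← map_comp_apply]
    refine X.map_mem_degenerateElements _ (fun hinj => hi ?_) z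
    refine hinj ?_
    change Fin.predAbove i (α (f.toOrderHom i.castSucc)) = Fin.predAbove i (α (f.toOrderHom i.succ))
    have h1 : α (f.toOrderHom i.castSucc) = i.castSucc := if_pos rfl
    have h2 : α (f.toOrderHom i.succ) = i.succ := by
      simp only [α, if_neg (Ne.symm hi), if_pos]
    rw [h1, h2, Fin.predAbove_castSucc_self, Fin.predAbove_succ_self]
  have h1 := closure_minimal hsub ((hX m).preimage (X.map g.op).hom.continuous) hx
  rw [mem_preimage, hy1] at h1
  exact hy h1

/-- The bijection between natural numbers and objects of the simplex category. -/
def natEquiv : ℕ ≃ SimplexCategory := ⟨.mk, SimplexCategory.len, fun _ => rfl, fun _ => rfl⟩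

/-- The quotient map onto the ordinary realization. -/
def toSlim : C(Σ n : ℕ, X.obj (op ⦋n⦌) × stdSimplex ℝ (Fin (n + 1)), SlimRealization X) :=
  ⟨fun z => Quot.mk _ ⟨⦋z.1⦌, z.2⟩, (isQuotientMap_quotMk_sigma
    (P := fun n => X.obj (op n) × stdSimplex ℝ (Fin (n.len + 1))) natEquiv _).continuous⟩

theorem isQuotientMap_toSlim : IsQuotientMap X.toSlim :=
  isQuotientMap_quotMk_sigma (P := fun n => X.obj (op n) × stdSimplex ℝ (Fin (n.len + 1)))
    natEquiv _

theorem toSlim_map {m n : ℕ} (f : ⦋m⦌ ⟶ ⦋n⦌) (x : X.obj (op ⦋n⦌))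
    (s : stdSimplex ℝ (Fin (m + 1))) :
    X.toSlim ⟨m, X.map f.op x, s⟩ = X.toSlim ⟨n, x, stdSimplex.map f.toOrderHom s⟩ :=
  Quot.sound (.glue f x s)

/-- `b` is obtained from `a` by restricting to the face of the simplex on which `a` is supported,
and then writing the element of `X` as a degeneracy of a nondegenerate element. -/
def IsNormalForm (a : Σ n : SimplexCategory, X.obj (op n) × stdSimplex ℝ (Fin (n.len + 1)))
    (b : Σ n : ℕ, X.obj (op ⦋n⦌) × stdSimplex ℝ (Fin (n + 1))) : Prop :=
  ∃ (k : ℕ) (f : ⦋k⦌ ⟶ a.1) (g : ⦋k⦌ ⟶ ⦋b.1⦌) (t : stdSimplex ℝ (Fin (k + 1))),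
    Mono f ∧ Epi g ∧ (∀ i, t i ≠ 0) ∧ stdSimplex.map f.toOrderHom t = a.2.2 ∧
      stdSimplex.map g.toOrderHom t = b.2.2 ∧ X.map f.op a.2.1 = X.map g.op b.2.1 ∧
      b.2.1 ∉ degenerateElements X b.1

theorem isNormalForm_self {b : Σ n : ℕ, X.obj (op ⦋n⦌) × stdSimplex ℝ (Fin (n + 1))}
    (hb : b.2.1 ∉ degenerateElements X b.1) (hb' : ∀ i, b.2.2 i ≠ 0) :
    X.IsNormalForm ⟨⦋b.1⦌, b.2⟩ b :=
  ⟨b.1, 𝟙 _, 𝟙 _, b.2.2, inferInstance, inferInstance, hb', stdSimplex.map_eq_self fun _ _ => rfl,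
    stdSimplex.map_eq_self fun _ _ => rfl, rfl, hb⟩

/-- The epi-mono factorization of `ι ≫ f` gives the new support face. Pushing `t` along the epi
keeps it interior, and Eilenberg–Zilber uniqueness shows that the nondegenerate part is unchanged.
-/
theorem IsNormalForm.of_rel {a a' b} (h : SlimRealizationRel X a a') (hb : X.IsNormalForm a b) :
    X.IsNormalForm a' b := by
  obtain ⟨f, x, s⟩ := h
  rename_i m n
  obtain ⟨l, y, s'⟩ := b
  obtain ⟨k, ι, g, t, hι, hg, ht, h1, h2, h3, hy⟩ := hb
  dsimp only at ι g h1 h2 h3 hy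
  obtain ⟨k', π, ι', hπ, hι', hfac⟩ : ∃ (k' : ℕ) (π : ⦋k⦌ ⟶ ⦋k'⦌) (ι' : ⦋k'⦌ ⟶ n),
      Epi π ∧ Mono ι' ∧ π ≫ ι' = ι ≫ f :=
    ⟨(Limits.image (ι ≫ f)).len, Limits.factorThruImage (ι ≫ f), Limits.image.ι (ι ≫ f),
      inferInstanceAs (Epi (Limits.factorThruImage (ι ≫ f))),
      inferInstanceAs (Mono (Limits.image.ι (ι ≫ f))), Limits.image.fac (ι ≫ f)⟩
  obtain ⟨l', g', y', hg', hy', h4⟩ := X.exists_nonDegenerate (X.map ι'.op x)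
  have h5 : X.map (π ≫ g').op y' = X.map g.op y := by
    rw [← h3, map_comp_apply, ← h4, ← map_comp_apply, ← map_comp_apply, hfac]
  have h6 := X.nonDegenerate_unique hy' hy h5
  simp only [Sigma.mk.injEq] at h6
  obtain ⟨rfl, h6⟩ := h6
  simp only [heq_eq_eq, Prod.mk.injEq] at h6
  obtain ⟨rfl, rfl⟩ := h6
  refine ⟨k', ι', g', stdSimplex.map π.toOrderHom t, hι', hg', fun i => ?_, ?_, ?_, h4, hy⟩
  · obtain ⟨j, hj⟩ := SimplexCategory.epi_iff_surjective.1 hπ i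
    exact stdSimplex.map_apply_ne_zero_iff.2 ⟨j, hj, ht j⟩
  · dsimp only
    rw [← h1, stdSimplex.map_comp_apply, stdSimplex.map_comp_apply]
    have h7 : ι'.toOrderHom ∘ π.toOrderHom = f.toOrderHom ∘ ι.toOrderHom :=
      funext fun i => DFunLike.congr_fun (congrArg SimplexCategory.Hom.toOrderHom hfac) i
    exact congrArg (fun h => stdSimplex.map h t) h7
  · rw [stdSimplex.map_comp_apply]
    exact h2

theorem exists_isNormalForm (a) : ∃ b, X.IsNormalForm a b := by
  obtain ⟨n, x, s⟩ := a
  obtain ⟨k, f, t, ht, hts⟩ := stdSimplex.exists_support_embedding s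
  let f' : ⦋k⦌ ⟶ n := SimplexCategory.Hom.mk f.toOrderHom
  obtain ⟨m, g, y, hg, hy, h⟩ := X.exists_nonDegenerate (X.map f'.op x)
  exact ⟨⟨m, y, stdSimplex.map g.toOrderHom t⟩, k, f', g, t,
    SimplexCategory.mono_iff_injective.2 f.injective, hg, ht, hts, rfl, h, hy⟩

theorem IsNormalForm.unique {a b b'} (h : X.IsNormalForm a b) (h' : X.IsNormalForm a b') :
    b = b' := by
  obtain ⟨n, x, s⟩ := a
  obtain ⟨l, y, r⟩ := b
  obtain ⟨l', y', r'⟩ := b'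
  obtain ⟨k, f, g, t, hf, hg, ht, h1, h2, h3, hy⟩ := h
  obtain ⟨k', f', g', t', hf', hg', ht', h1', h2', h3', hy'⟩ := h'
  dsimp only at f f' g g' h1 h2 h3 h1' h2' h3' hy hy'
  have hs {k : ℕ} (f : ⦋k⦌ ⟶ n) [hf : Mono f] : StrictMono f.toOrderHom :=
    f.toOrderHom.monotone.strictMono_of_injective (SimplexCategory.mono_iff_injective.1 hf)
  have h4 := stdSimplex.support_embedding_unique (f := OrderEmbedding.ofStrictMono _ (hs f))
    (f' := OrderEmbedding.ofStrictMono _ (hs f')) ht ht' (h1.trans h1'.symm)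
  simp only [Sigma.mk.injEq] at h4
  obtain ⟨rfl, h4⟩ := h4
  simp only [heq_eq_eq, Prod.mk.injEq] at h4
  obtain ⟨h4, rfl⟩ := h4
  obtain rfl : f = f' := by
    ext i : 3
    exact DFunLike.congr_fun h4 i
  have h5 := X.nonDegenerate_unique hy hy' (h3.symm.trans h3')
  simp only [Sigma.mk.injEq] at h5
  obtain ⟨rfl, h5⟩ := h5
  simp only [heq_eq_eq, Prod.mk.injEq] at h5
  obtain ⟨rfl, rfl⟩ := h5
  rw [← h2, ← h2']

/-- The ordinary realization of a proper simplicial space. -/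
noncomputable def slimPresentation (hX : IsProperSimplicialSpace X) :
    SimplicialPresentation (fun n => X.obj (op ⦋n⦌)) (SlimRealization X) where
  q := X.toSlim
  isQuotientMap := X.isQuotientMap_toSlim
  A n := degenerateElements X n
  A_zero := X.toSSet.degenerate_zero
  cof n := (IsHurewiczCofibration.nonempty_cofibrationData (hX n).1 (hX n).2).some
  B n i := Set.range (X.map (SimplexCategory.σ i).op)
  isClosed_B n i := X.isClosed_range_degeneracy (fun n => (hX n).1) i
  A_succ := X.degenerateElements_succ
  d n i := (X.map (SimplexCategory.δ i).op).hom
  q_d n i x s := (X.toSlim_map (SimplexCategory.δ i) x s).symm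
  q_of_mem_B n i x s := by
    rintro ⟨x, rfl⟩
    have h : (X.map (SimplexCategory.δ i.castSucc).op).hom (X.map (SimplexCategory.σ i).op x) = x := by
      change X.map (SimplexCategory.δ i.castSucc).op (X.map (SimplexCategory.σ i).op x) = x
      rw [← map_comp_apply, SimplexCategory.δ_comp_σ_self]
      simp
    rw [h]
    exact X.toSlim_map (SimplexCategory.σ i) x s
  eq_of_q_eq a b ha ha' hb hb' h :=
    Quot.eq_of_normalForm X.IsNormalForm (fun _ _ _ => IsNormalForm.of_rel X)
      X.exists_isNormalForm (fun _ _ _ => IsNormalForm.unique X)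
      (X.isNormalForm_self ha ha') (X.isNormalForm_self hb hb') h
  v n := (X.map (SimplexCategory.const ⦋0⦌ ⦋n⦌ 0).op).hom
  q_v n x := by
    refine Eq.trans ?_ (X.toSlim_map (SimplexCategory.const ⦋0⦌ ⦋n⦌ 0) x (stdSimplex.vertex 0)).symm
    rw [stdSimplex.map_vertex]
    rfl

end SimplicialSpace

theorem proposition4p1 :
    (∀ X : SemisimplicialSpace.{u},
      IsDoldSpace (X.obj (op ⦋0⦌ₛ)) → IsDoldSpace (FatRealization X)) ∧
    (∀ X : SimplicialSpace.{u}, IsProperSimplicialSpace X →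
      IsDoldSpace (X.obj (op ⦋0⦌)) → IsDoldSpace (SlimRealization X)) :=
  ⟨fun X h => (SemisimplicialSpace.fatPresentation X).isDoldSpace h,
    fun X hX h => (SimplicialSpace.slimPresentation X hX).isDoldSpace h⟩
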